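/- **Definitions.** Let $\mathbb H=\{z\in\mathbb C:\operatorname{Re}z>0\}$ and $S=\{x+iy: x>4,\ |y|<\pi\}$. Let $\mathcal T$ be the set of unbounded simply connected domains $T\subset S$ with $5\in T$ such that $\partial T$ is locally connected and there is only one access to infinity in $T$, i.e. any two curves in $T$ connecting the same finite endpoint to infinity are homotopic (in $T$, with the endpoints fixed). Let $\mathcal H$ be the class of conformal isomorphisms $F\colon T\to\mathbb H$, $T\in\mathcal T$, with $F(5)=5$ that extend continuously to $\infty$ with $F(\infty)=\infty$. For $\nu>0$, let $\mathcal H_\nu$ be the class of $F\in\mathcal H$ such that the Euclidean diameter of $F^{-1}(\{w\in\mathbb H:|w|=R\})$ is at most $\nu$ for every $R>0$. The one-dimensional projection of $F\in\mathcal H$ is $\phi(t)=\operatorname{Re}F^{-1}(t)$, $t\in[4,\infty)$; it maps $[4,\infty)$ to itself. Let $\hat F\colon T+2\pi i\mathbb Z\to\mathbb H$ be the $2\pi i$-periodic extension of $F$, and let $J(\hat F)$ be the set of $z\in\mathbb H$ such that $\hat F^n(z)$ is defined and belongs to $T+2\pi i\mathbb Z$ for all $n\ge0$. For a sequence $\underline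 s=(s_n)_{n\ge 0}$ of integers let $J_{\underline s}(\hat F)=\{z\in J(\hat F):\hat F^n(z)\in T+2\pi i s_n\text{ for all }n\ge0\}$. If this set is non-empty, then $J_{\underline s}(\hat F)\cup\{\infty\}\subset\hat{\mathbb C}$ (with the spherical metric) is called a Julia continuum of $\hat F$. A continuum is a non-empty compact connected metric space $X$. It is arc-like if for every $\varepsilon>0$ there is a continuous surjection $g\colon X\to[0,1]$ with $\operatorname{diam}g^{-1}(t)\le\varepsilon$ for all $t\in[0,1]$; it is hereditarily indecomposable if any two intersecting subcontinua are nested. A pseudo-arc is a hereditarily indecomposable arc-like continuum. A quadruple $Q=(A<B<C<D)$ consists of real numbers $\geq 9$; its size is $|Q|=\min(A-5,B-A,C-B,D-C)$. The iterate $\phi^k$ maps a closed interval $I$ crookedly over $Q$ if $\phi^k(I)\supset[A,D]$ and the convex hull of $I\cap\phi^{-k}(B)$ intersects the convex hull of $I\cap\phi^{-k}(C)$. **Theorem.** Let $F\in\mathcal H_\nu$ for some $\nu>0$, and let $\phi$ be its one-dimensional projection. Suppose that there is a constant $K>0$ such that, for every quadruple $Q=(A<B<C<D)$ of integers with $|Q|\ge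 K$, there is $k_0=k_0(Q)\in\mathbb N$ such that for every $k\ge k_0$ and every compact interval $I\subset[6,\infty)$ with $\phi^k(I)\supset[A,D]$, the iterate $\phi^k$ maps $I$ crookedly over $Q$. Then every Julia continuum of $\hat F$ is a pseudo-arc. -/

import Mathlib

open Set Filter Topology Bornology

noncomputable section

namespace PseudoArcModels

/-! ### The Riemann sphere with its chordal metric -/

/-- Inverse stereographic projection from `ℂ ∪ {∞}` onto the unit sphere of `ℂ × ℝ = ℝ³`
(with the Euclidean norm); the point `∞` goes to the north pole. -/
def toSphere : OnePoint ℂ → WithLp 2 (ℂ × ℝ)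
  | OnePoint.infty => WithLp.toLp 2 (0, 1)
  | OnePoint.some z =>
      WithLp.toLp 2 (((2 / (1 + ‖z‖ ^ 2) : ℝ) : ℂ) * z, (‖z‖ ^ 2 - 1) / (‖z‖ ^ 2 + 1))

theorem toSphere_infty : toSphere OnePoint.infty = WithLp.toLp 2 (0, 1) := rfl

theorem toSphere_coe (z : ℂ) : toSphere (z : OnePoint ℂ) =
    WithLp.toLp 2 (((2 / (1 + ‖z‖ ^ 2) : ℝ) : ℂ) * z, (‖z‖ ^ 2 - 1) / (‖z‖ ^ 2 + 1)) := rfl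

theorem toSphere_injective : Function.Injective toSphere := by
  have key : ∀ z : ℂ, (‖z‖ ^ 2 - 1) / (‖z‖ ^ 2 + 1) = 1 - 2 / (1 + ‖z‖ ^ 2) := by
    intro z
    have : (1 + ‖z‖ ^ 2) ≠ 0 := by positivity
    have : (‖z‖ ^ 2 + 1) ≠ 0 := by positivity
    field_simp
    ring
  have pos : ∀ z : ℂ, 0 < 2 / (1 + ‖z‖ ^ 2) := fun z => by positivity
  intro x y h
  induction x using OnePoint.rec with
  | infty =>
    induction y using OnePoint.rec with
    | infty => rfl
    | coe w =>
      exfalso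
      rw [toSphere_infty, toSphere_coe] at h
      have h2 := congrArg (fun p => (WithLp.ofLp p).2) h
      simp only [key] at h2
      linarith [pos w]
  | coe z =>
    induction y using OnePoint.rec with
    | infty =>
      exfalso
      rw [toSphere_infty, toSphere_coe] at h
      have h2 := congrArg (fun p => (WithLp.ofLp p).2) h
      simp only [key] at h2
      linarith [pos z]
    | coe w =>
      rw [toSphere_coe, toSphere_coe] at h
      have h2 := congrArg (fun p => (WithLp.ofLp p).2) h
      have h1 := congrArg (fun p => (WithLp.ofLp p).1) h
      simp only [key] at h2
      have h3 : 2 / (1 + ‖z‖ ^ 2) = 2 / (1 + ‖w‖ ^ 2) := by linarith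
      simp only [h3] at h1
      have h4 : (((2 / (1 + ‖w‖ ^ 2) : ℝ)) : ℂ) ≠ 0 := by
        exact_mod_cast (pos w).ne'
      rw [mul_left_cancel₀ h4 h1]

theorem continuous_toSphere : Continuous toSphere := by
  rw [OnePoint.continuous_iff]
  have hn : Tendsto (fun z : ℂ => ‖z‖ ^ 2) (coclosedCompact ℂ) atTop := by
    rw [coclosedCompact_eq_cocompact]
    exact (tendsto_pow_atTop two_ne_zero).comp (tendsto_norm_cocompact_atTop)
  have hn1 : Tendsto (fun z : ℂ => 1 + ‖z‖ ^ 2) (coclosedCompact ℂ) atTop :=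
    tendsto_atTop_add_const_left _ _ hn
  have h0 : Tendsto (fun z : ℂ => 2 / (1 + ‖z‖ ^ 2)) (coclosedCompact ℂ) (𝓝 0) :=
    hn1.const_div_atTop 2
  constructor
  · rw [toSphere_infty]
    simp only [toSphere_coe]
    refine ((WithLp.prod_continuous_toLp 2 ℂ ℝ).tendsto _).comp (Tendsto.prodMk_nhds ?_ ?_)
    · have hinv : Tendsto (fun z : ℂ => ‖z‖⁻¹) (coclosedCompact ℂ) (𝓝 0) := by
        rw [coclosedCompact_eq_cocompact]
        exact tendsto_inv_atTop_zero.comp (tendsto_norm_cocompact_atTop)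
      have hinv2 : Tendsto (fun z : ℂ => 2 * ‖z‖⁻¹) (coclosedCompact ℂ) (𝓝 0) := by
        simpa using hinv.const_mul 2
      refine squeeze_zero_norm (fun z => ?_) hinv2
      rw [norm_mul, Complex.norm_real, Real.norm_of_nonneg (by positivity)]
      rcases eq_or_ne (‖z‖) 0 with hz | hz
      · simp [hz]
      · have : 0 < ‖z‖ := lt_of_le_of_ne (norm_nonneg z) hz.symm
        rw [div_mul_eq_mul_div, ← div_eq_mul_inv, div_le_div_iff₀ (by positivity) this]
        nlinarith
    · have : Tendsto (fun z : ℂ => 1 - 2 / (1 + ‖z‖ ^ 2)) (coclosedCompact ℂ) (𝓝 1) := by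
        simpa using h0.const_sub 1
      refine this.congr fun z => ?_
      have : (1 + ‖z‖ ^ 2) ≠ 0 := by positivity
      have : (‖z‖ ^ 2 + 1) ≠ 0 := by positivity
      field_simp
      ring
  · refine (WithLp.prod_continuous_toLp 2 ℂ ℝ).comp (Continuous.prodMk ?_ ?_)
    · refine (Complex.continuous_ofReal.comp ?_).mul continuous_id
      exact continuous_const.div (by fun_prop) (fun z => by positivity)
    · exact Continuous.div (by fun_prop) (by fun_prop) (fun z => by positivity)

/-- The Riemann sphere `OnePoint ℂ` carries the chordal metric; it induces the topology of the
one-point compactification. -/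
instance : MetricSpace (OnePoint ℂ) :=
  (continuous_toSphere.isClosedEmbedding toSphere_injective).isEmbedding.comapMetricSpace toSphere

/-! ### Continua -/

/-- A continuum: a non-empty compact connected metric space. -/
def IsContinuum (X : Type*) [MetricSpace X] : Prop :=
  CompactSpace X ∧ ConnectedSpace X

/-- An arc-like continuum: for every `ε > 0` there is a continuous surjection onto `[0,1]` all of
whose fibres have diameter at most `ε`. -/
def IsArcLike (X : Type*) [MetricSpace X] : Prop :=
  IsContinuum X ∧ ∀ ε : ℝ, 0 < ε → ∃ g : X → Icc (0 : ℝ) 1,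
    Continuous g ∧ Function.Surjective g ∧ ∀ t, Metric.diam (g ⁻¹' {t}) ≤ ε

/-- A hereditarily indecomposable continuum: any two intersecting subcontinua are nested. -/
def IsHereditarilyIndecomposable (X : Type*) [MetricSpace X] : Prop :=
  IsContinuum X ∧ ∀ A B : Set X, IsCompact A → IsConnected A → IsCompact B → IsConnected B →
    (A ∩ B).Nonempty → A ⊆ B ∨ B ⊆ A

/-- A pseudo-arc: a hereditarily indecomposable arc-like continuum. -/
def IsPseudoArc (X : Type*) [MetricSpace X] : Prop :=
  IsHereditarilyIndecomposable X ∧ IsArcLike X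

/-! ### Tracts and the class `𝓗` -/

/-- The open right half-plane `ℍ`. -/
def rightHalfPlane : Set ℂ := {z | 0 < z.re}

/-- The half-strip `S`. -/
def halfStrip : Set ℂ := {z | 4 < z.re ∧ |z.im| < Real.pi}

/-- `γ : [0,∞) → T` is a curve in `T` that connects `z₀` to infinity. -/
def IsCurveToInfinity (T : Set ℂ) (z₀ : ℂ) (γ : ℝ → ℂ) : Prop :=
  ContinuousOn γ (Ici 0) ∧ MapsTo γ (Ici 0) T ∧ γ 0 = z₀ ∧ Tendsto γ atTop (cobounded ℂ)

/-- The curves `γ₀`, `γ₁` from `z₀` to infinity are homotopic in `T`, with both endpoints `z₀` and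
`∞` fixed during the homotopy: `H s t → ∞` as `t → ∞`, uniformly in `s ∈ [0,1]`, which is
continuity of the homotopy at the endpoint `∞`. -/
def HomotopicToInfinity (T : Set ℂ) (z₀ : ℂ) (γ₀ γ₁ : ℝ → ℂ) : Prop :=
  ∃ H : ℝ → ℝ → ℂ,
    ContinuousOn (fun p : ℝ × ℝ => H p.1 p.2) (Icc 0 1 ×ˢ Ici 0) ∧
    (∀ s ∈ Icc (0 : ℝ) 1, ∀ t ∈ Ici (0 : ℝ), H s t ∈ T) ∧
    (∀ t ∈ Ici (0 : ℝ), H 0 t = γ₀ t) ∧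
    (∀ t ∈ Ici (0 : ℝ), H 1 t = γ₁ t) ∧
    (∀ s ∈ Icc (0 : ℝ) 1, H s 0 = z₀) ∧
    Tendsto (fun p : ℝ × ℝ => H p.1 p.2) (𝓟 (Icc 0 1) ×ˢ atTop) (cobounded ℂ)

/-- The set `𝒯` of tracts. -/
structure IsTract (T : Set ℂ) : Prop where
  isOpen : IsOpen T
  isSimplyConnected : IsSimplyConnected T
  subset_halfStrip : T ⊆ halfStrip
  five_mem : (5 : ℂ) ∈ T
  unbounded : ¬ IsBounded T
  locallyConnected_frontier : LocallyConnectedSpace (frontier T)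
  /-- There is only one access to infinity in `T`. -/
  unique_access : ∀ z₀ : ℂ, ∀ γ₀ γ₁ : ℝ → ℂ, IsCurveToInfinity T z₀ γ₀ →
    IsCurveToInfinity T z₀ γ₁ → HomotopicToInfinity T z₀ γ₀ γ₁

/-- `F : T → ℍ` belongs to the class `𝓗`: `T` is a tract, and `F` is a conformal isomorphism from
`T` onto `ℍ` with `F 5 = 5` that extends continuously to `∞` with `F(∞) = ∞`. The values of `F`
outside `T` are irrelevant. -/
structure ClassH (T : Set ℂ) (F : ℂ → ℂ) : Prop where
  isTract : IsTract T
  differentiableOn : DifferentiableOn ℂ F T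
  bijOn : BijOn F T rightHalfPlane
  map_five : F 5 = 5
  tendsto_infty : Tendsto F (cobounded ℂ ⊓ 𝓟 T) (cobounded ℂ)

/-- The subclass `𝓗_ν`: moreover, all the sets `F⁻¹({w ∈ ℍ : |w| = R})`, for `R > 0`, have
Euclidean diameter at most `ν`. -/
structure ClassHnu (ν : ℝ) (T : Set ℂ) (F : ℂ → ℂ) : Prop extends ClassH T F where
  ediam_le : ∀ R : ℝ, 0 < R →
    Metric.ediam (T ∩ F ⁻¹' {w ∈ rightHalfPlane | ‖w‖ = R}) ≤ ENNReal.ofReal ν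

/-- The one-dimensional projection `φ(t) = Re F⁻¹(t)`; relevant for `t ≥ 4` only, where
`φ(t) > 4`. Here `F⁻¹ : ℍ → T` is the inverse of `F : T → ℍ`. -/
def oneDimProjection (T : Set ℂ) (F : ℂ → ℂ) (t : ℝ) : ℝ :=
  (Function.invFunOn F T (t : ℂ)).re

/-! ### The periodic extension and its Julia continua -/

/-- The translate `T + 2πin`. -/
def translate (T : Set ℂ) (n : ℤ) : Set ℂ :=
  {z | z - 2 * Real.pi * Complex.I * n ∈ T}

/-- The domain `T + 2πiℤ` of the periodic extension. -/
def periodicDomain (T : Set ℂ) : Set ℂ := ⋃ n : ℤ, translate T n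

open Classical in
/-- The `2πi`-periodic extension `F̂ : T + 2πiℤ → ℍ`, given by `F̂(z) = F(z - 2πin)` for
`z ∈ T + 2πin`. Outside `T + 2πiℤ`, where `F̂` is not defined, it has the dummy value `0`. -/
def periodicExtension (T : Set ℂ) (F : ℂ → ℂ) (z : ℂ) : ℂ :=
  if h : ∃ n : ℤ, z ∈ translate T n then F (z - 2 * Real.pi * Complex.I * h.choose) else 0

theorem eq_of_mem_translate {T : Set ℂ} (hT : T ⊆ halfStrip) {z : ℂ} {m n : ℤ}
    (hm : z ∈ translate T m) (hn : z ∈ translate T n) : m = n := by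
  have h1 := (hT hm).2
  have h2 := (hT hn).2
  simp only [Complex.sub_im, Complex.mul_im, Complex.mul_re, Complex.I_re, Complex.I_im,
    Complex.ofReal_re, Complex.ofReal_im, Complex.intCast_re, Complex.intCast_im,
    Complex.re_ofNat, Complex.im_ofNat, mul_zero, mul_one, zero_mul, add_zero, zero_add,
    sub_zero, sub_self] at h1 h2
  rw [abs_lt] at h1 h2
  have hpi := Real.pi_pos
  have hlt : ((m : ℝ) - n) < 1 := by
    by_contra hc
    push Not at hc
    nlinarith
  have hgt : -1 < ((m : ℝ) - n) := by
    by_contra hc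
    push Not at hc
    nlinarith
  have hlt' : m - n < 1 := by exact_mod_cast hlt
  have hgt' : -1 < m - n := by exact_mod_cast hgt
  omega

theorem periodicExtension_of_mem {T : Set ℂ} (hT : T ⊆ halfStrip) (F : ℂ → ℂ) {z : ℂ} {n : ℤ}
    (hz : z ∈ translate T n) :
    periodicExtension T F z = F (z - 2 * Real.pi * Complex.I * n) := by
  have h : ∃ n : ℤ, z ∈ translate T n := ⟨n, hz⟩
  rw [periodicExtension, dif_pos h, eq_of_mem_translate hT h.choose_spec hz]

/-- `J(F̂)`: the points of `ℍ` whose whole orbit under `F̂` is defined and stays in `T + 2πiℤ`. -/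
def juliaSet (T : Set ℂ) (F : ℂ → ℂ) : Set ℂ :=
  {z ∈ rightHalfPlane | ∀ n : ℕ, (periodicExtension T F)^[n] z ∈ periodicDomain T}

/-- `J_s(F̂)`: the points of `J(F̂)` with external address `s = s₀ s₁ s₂ …`. -/
def juliaSetAt (T : Set ℂ) (F : ℂ → ℂ) (s : ℕ → ℤ) : Set ℂ :=
  {z ∈ juliaSet T F | ∀ n : ℕ, (periodicExtension T F)^[n] z ∈ translate T (s n)}

/-- `Ĵ_s(F̂) = J_s(F̂) ∪ {∞}`, a subset of the Riemann sphere. -/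
def juliaSetAtHat (T : Set ℂ) (F : ℂ → ℂ) (s : ℕ → ℤ) : Set (OnePoint ℂ) :=
  insert OnePoint.infty ((fun z : ℂ => (z : OnePoint ℂ)) '' juliaSetAt T F s)

/-- `X` is a Julia continuum of `F̂`: `X = Ĵ_s(F̂)` for an address `s` with `J_s(F̂) ≠ ∅`. -/
def IsJuliaContinuum (T : Set ℂ) (F : ℂ → ℂ) (X : Set (OnePoint ℂ)) : Prop :=
  ∃ s : ℕ → ℤ, (juliaSetAt T F s).Nonempty ∧ X = juliaSetAtHat T F s

/-! ### Quadruples and crookedness -/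

/-- A quadruple: four different real numbers `≥ 9`, in increasing order. -/
structure Quadruple where
  A : ℝ
  B : ℝ
  C : ℝ
  D : ℝ
  nine_le : 9 ≤ A
  A_lt_B : A < B
  B_lt_C : B < C
  C_lt_D : C < D

/-- All four entries are integers. -/
def Quadruple.IsInteger (Q : Quadruple) : Prop :=
  ∃ a b c d : ℤ, Q.A = a ∧ Q.B = b ∧ Q.C = c ∧ Q.D = d

/-- The size `|Q|`. -/
def Quadruple.size (Q : Quadruple) : ℝ :=
  min (Q.A - 5) (min (Q.B - Q.A) (min (Q.C - Q.B) (Q.D - Q.C)))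

/-- `φ^k` maps `I` crookedly over `Q`. -/
def MapsCrookedly (φ : ℝ → ℝ) (k : ℕ) (I : Set ℝ) (Q : Quadruple) : Prop :=
  Icc Q.A Q.D ⊆ φ^[k] '' I ∧
    (convexHull ℝ (I ∩ φ^[k] ⁻¹' {Q.B}) ∩ convexHull ℝ (I ∩ φ^[k] ⁻¹' {Q.C})).Nonempty

end PseudoArcModels

end

open Set Filter Topology Bornology

noncomputable section

namespace PseudoArcModels

/-! Write `G = F⁻¹ : ℍ → T`. Since `T` lies in a strip of height `2π`, the Schwarz-Pick lemma gives
`|G'(w)| ≤ 2 / Re w`. Hence the inverse branches of `F̂` contract by `1/2` on `{Re z ≥ 4}`, and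
`J_s` is the nested intersection of the images of this half-plane under them.

Continua: for the images, with `∞` added, to be closed and connected, one needs `G(w) → ∞` as `w →
∞`, which is not immediate from `F(∞) = ∞`. This is `ClassHnu.tendsto_oneDimProjection`, proved by
the length-area method, local connectivity of `∂T` and a Janiszewski-type separation theorem.

Arc-likeness: along a fixed address, the imaginary parts of `F̂ⁿ` lie in an interval of length `2π`,
so `Re F̂ⁿ` determines a point of `J_s` up to an error `O(2⁻ⁿ)`. The coordinate `1 / Re F̂ⁿ`
therefore has small fibres.

Indecomposability: the bound `ν` makes `Re F̂ⁿ(z)` close to `φ(|F̂ⁿ⁺¹(z)|)`. The modulus is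
comparable to the height `max (Re F̂ⁿ(z), 2π|sₙ|)`, and `φ` is 2-Lipschitz in `log t`. So `φ`
carries heights at time `n + 1` to heights at time `n` with an error `2ν + 4` that does not
accumulate (`ClassHnu.exists_lift_interval`). Suppose that two intersecting subcontinua `A`, `B`
have points `a ∈ A \ B` and `b ∈ B \ A`. By expansion, at late times the height of `a` is far from
all heights on `B`, and that of `b` far from all heights on `A`. Place a large quadruple between the
two heights and lift it by `φ^k`. The preimages of `Q.B` are then heights attained on `A` only,
those of `Q.C` heights attained on `B` only. These two kinds of heights form disjoint intervals, so
the convex hulls cannot meet, contrary to crookedness (`ClassHnu.false_of_height_gaps`). -/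

/-! ### Logarithms and separation in the plane -/

/-- If `a` and `b` are joined by a path in `T`, then `(z - a) / (z - b)` has a continuous logarithm
on the complement of `T`. -/
theorem exists_log_div_compl {T : Set ℂ} {a b : ℂ} (h : JoinedIn T b a) :
    ∃ L : ℂ → ℂ, ContinuousOn L Tᶜ ∧ ∀ z ∈ Tᶜ, Complex.exp (L z) * (z - b) = z - a := by
  classical
  obtain ⟨γ, hγ⟩ := h
  have hne : ∀ (s : unitInterval) (z : (Tᶜ : Set ℂ)), (z : ℂ) - γ s ≠ 0 := fun s z hz =>
    z.2 (by rw [sub_eq_zero.1 hz]; exact hγ s)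
  have hb : ∀ z : (Tᶜ : Set ℂ), (z : ℂ) - b ≠ 0 := fun z => by simpa using hne 0 z
  -- Moving `a` to `b` along the path deforms the quotient to the constant `1`, whose logarithm is
  -- `0`; the homotopy is then lifted through the covering `exp`.
  let H : C(unitInterval × (Tᶜ : Set ℂ), {z : ℂ // z ≠ 0}) :=
    ⟨fun p => ⟨((p.2 : ℂ) - γ p.1) / ((p.2 : ℂ) - b), div_ne_zero (hne _ _) (hb _)⟩, by
      refine Continuous.subtype_mk ?_ _
      exact Continuous.div (by fun_prop) (by fun_prop) fun p => hb p.2⟩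
  have H0 : ∀ z : (Tᶜ : Set ℂ), H (0, z) =
      (fun z : ℂ ↦ (⟨_, z.exp_ne_zero⟩ : {z : ℂ // z ≠ 0}))
        ((ContinuousMap.const _ 0 : C((Tᶜ : Set ℂ), ℂ)) z) := by
    intro z
    apply Subtype.ext
    simp [H, div_self (hb z)]
  set Λ := Complex.isCoveringMap_exp.liftHomotopy H _ H0 with hΛ
  refine ⟨fun z => if hz : z ∈ Tᶜ then Λ (1, ⟨z, hz⟩) else 0, ?_, ?_⟩
  · rw [continuousOn_iff_continuous_domRestrict]
    have : Continuous fun z : (Tᶜ : Set ℂ) => Λ (1, z) := by fun_prop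
    refine this.congr fun z => ?_
    have hz : (z : ℂ) ∉ T := z.2
    simp [hz]
  · intro z hz
    have h1 := congrFun (Complex.isCoveringMap_exp.liftHomotopy_lifts H _ H0) (1, ⟨z, hz⟩)
    have h2 := congrArg Subtype.val h1
    simp only [Function.comp_apply, H, ContinuousMap.coe_mk, γ.target] at h2
    simp only [dif_pos hz]
    rw [hΛ, h2, div_mul_cancel₀ _ (hb ⟨z, hz⟩)]

theorem isSimplyConnected_of_convex {s : Set ℂ} (hs : Convex ℝ s) (hne : s.Nonempty) :
    IsSimplyConnected s :=
  have := hs.contractibleSpace hne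
  SimplyConnectedSpace.ofContractible s

/-- The function `z - a` near infinity has no continuous non-vanishing extension to the plane. -/
theorem no_nonvanishing_extension {h : ℂ → ℂ} (hc : Continuous h) (h0 : ∀ z, h z ≠ 0) {a : ℂ}
    {R : ℝ} (hR : 0 < R) (hh : ∀ z, ‖z - a‖ = R → h z = z - a) : False := by
  obtain ⟨ℓ, hℓc, hℓ⟩ := Complex.exists_continuousOn_eqOn_exp_comp (U := (univ : Set ℂ))
    (isSimplyConnected_of_convex convex_univ univ_nonempty) isOpen_univ
    hc.continuousOn (by rintro ⟨z, -, hz⟩; exact h0 z hz)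
  have hℓc : Continuous ℓ := continuousOn_univ.1 hℓc
  -- A global logarithm of `h` would make `q` continuous with `exp ∘ q` constant, hence `q`
  -- constant; but one turn around the circle changes `q` by `-2πi`.
  let q : ℝ → ℂ := fun θ => ℓ (a + R * Complex.exp (θ * Complex.I)) - θ * Complex.I
  have hq : Continuous q := by fun_prop
  have hqe : ∀ θ, Complex.exp (q θ) = R := by
    intro θ
    have h1 := hℓ (mem_univ (a + R * Complex.exp (θ * Complex.I)))
    rw [hh _ (by simp [Complex.norm_exp_ofReal_mul_I, hR.le])] at h1
    simp only [Function.comp_apply, add_sub_cancel_left] at h1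
    simp only [q]
    rw [Complex.exp_sub, h1, mul_div_assoc, div_self (Complex.exp_ne_zero _), mul_one]
  have hconst : ∀ θ, q θ = q 0 := by
    intro θ
    have hloc : IsLocallyConstant q := by
      rw [IsLocallyConstant.iff_eventually_eq]
      intro x
      have hev : ∀ᶠ y in 𝓝 x, ‖q y - q x‖ < 1 := by
        have := (hq.tendsto x).sub_const (q x)
        rw [sub_self] at this
        exact (this.norm).eventually (by simpa using gt_mem_nhds one_pos)
      filter_upwards [hev] with y hy
      have he := (hqe y).trans (hqe x).symm
      obtain ⟨n, hn⟩ := Complex.exp_eq_exp_iff_exists_int.1 he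
      rw [hn, add_sub_cancel_left] at hy
      have h3 : ‖(n : ℂ) * (2 * Real.pi * Complex.I)‖ = |(n : ℝ)| * (2 * Real.pi) := by
        simp [abs_of_pos Real.pi_pos]
      rw [h3] at hy
      have hn0 : n = 0 := by
        by_contra hne
        have : (1 : ℝ) ≤ |(n : ℝ)| := by exact_mod_cast Int.one_le_abs hne
        nlinarith [Real.pi_gt_three]
      simp [hn, hn0]
    exact hloc.apply_eq_of_isPreconnected isPreconnected_univ (mem_univ _) (mem_univ _)
  have := hconst (2 * Real.pi)
  simp only [q] at this
  push_cast at this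
  rw [Complex.exp_two_pi_mul_I] at this
  simp [Real.pi_ne_zero] at this

/-- A bounded set `U` cannot contain exactly one of two points `a`, `b` if
`(z - a) / (z - b)` has a continuous logarithm on the frontier of `U`. -/
theorem mem_of_log_on_frontier {U : Set ℂ} (hUb : IsBounded U) {a b : ℂ}
    (ha : a ∈ U) {L : ℂ → ℂ} (hLc : ContinuousOn L (frontier U))
    (hL : ∀ z ∈ frontier U, Complex.exp (L z) * (z - b) = z - a) : b ∈ U := by
  classical
  by_contra hb
  obtain ⟨Λ, hΛ⟩ := ContinuousMap.exists_restrict_eq (isClosed_frontier (s := U))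
    ⟨(frontier U).domRestrict L, continuousOn_iff_continuous_domRestrict.1 hLc⟩
  have hΛ' : ∀ z ∈ frontier U, Λ z = L z := fun z hz => congrArg (fun f => f ⟨z, hz⟩) hΛ
  -- With `Λ` a Tietze extension of `L`, the two formulas agree on the frontier. If `a ∈ U` and `b ∉
  -- U`, neither of them vanishes where it is used.
  let h : ℂ → ℂ := fun z => if z ∈ U then Complex.exp (Λ z) * (z - b) else z - a
  have hc : Continuous h := by
    refine continuous_if (fun z hz => ?_) (by fun_prop) (by fun_prop)
    have hz : z ∈ frontier U := hz
    rw [hΛ' z hz, hL z hz]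
  have h0 : ∀ z, h z ≠ 0 := by
    intro z
    by_cases hz : z ∈ U
    · simp only [h, if_pos hz]
      exact mul_ne_zero (Complex.exp_ne_zero _) (sub_ne_zero.2 fun e => hb (e ▸ hz))
    · simp only [h, if_neg hz]
      exact sub_ne_zero.2 fun e => hz (e ▸ ha)
  obtain ⟨R, hR⟩ := hUb.subset_ball a
  have hRpos : 0 < R := by simpa using hR ha
  refine no_nonvanishing_extension (a := a) hc h0 hRpos fun z hz => ?_
  have : z ∉ U := fun hzU => by
    have := hR hzU
    rw [Metric.mem_ball, dist_eq_norm] at this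
    linarith
  simp [h, this]

/-- A version of Janiszewski's theorem: if two closed sets cover the frontier of a bounded
set `U`, one is disjoint from a domain `T` and the other one lies in a ball, and they intersect in
a subset of a connected set `V` in their common domain, then points of `T` outside of the ball are
not separated by the frontier of `U`. -/
theorem mem_of_frontier_subset_union {U T C V : Set ℂ} (hUb : IsBounded U)
    (hT : IsOpen T) (hTc : IsConnected T) (hC : IsClosed C) {p : ℂ} {ε : ℝ}
    (hCp : C ⊆ Metric.ball p ε) (hV : IsPreconnected V) (hVT : V ⊆ Tᶜ)
    (hVp : V ⊆ Metric.ball p ε) (hCV : C ∩ Tᶜ ⊆ V) (hfr : frontier U ⊆ C ∪ Tᶜ) {a b : ℂ}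
    (haT : a ∈ T) (hbT : b ∈ T) (hap : a ∉ Metric.ball p ε) (hbp : b ∉ Metric.ball p ε)
    (ha : a ∈ U) : b ∈ U := by
  classical
  have hj : JoinedIn T b a :=
    ((hT.isConnected_iff_isPathConnected).1 hTc).joinedIn b hbT a haT
  obtain ⟨L₂, hc₂, hL₂⟩ := exists_log_div_compl hj
  have hball : ∃ L : ℂ → ℂ, ContinuousOn L (Metric.ball p ε) ∧
      ∀ z ∈ Metric.ball p ε, Complex.exp (L z) * (z - b) = z - a := by
    rcases le_or_gt ε 0 with hε | hε
    · simp [Metric.ball_eq_empty.2 hε]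
    · have hzb : ∀ z ∈ Metric.ball p ε, z - b ≠ 0 := fun z hz e => hbp (sub_eq_zero.1 e ▸ hz)
      have hza : ∀ z ∈ Metric.ball p ε, z - a ≠ 0 := fun z hz e => hap (sub_eq_zero.1 e ▸ hz)
      obtain ⟨L, hLc, hL⟩ := Complex.exists_continuousOn_eqOn_exp_comp
        (U := Metric.ball p ε) (g := fun z => (z - a) / (z - b))
        (isSimplyConnected_of_convex (convex_ball p ε) ⟨p, Metric.mem_ball_self hε⟩) Metric.isOpen_ball
        (ContinuousOn.div (by fun_prop) (by fun_prop) hzb)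
        (by rintro ⟨z, hz, e⟩; exact div_ne_zero (hza z hz) (hzb z hz) e)
      refine ⟨L, hLc, fun z hz => ?_⟩
      have := hL hz
      simp only [Function.comp_apply] at this
      rw [this, div_mul_cancel₀ _ (hzb z hz)]
  obtain ⟨L₁, hc₁, hL₁⟩ := hball
  -- Two logarithms of the same function differ by an element of `2πiℤ`, which is constant on the
  -- connected set `V`.
  have hconst : ∃ c : ℂ, Complex.exp c = 1 ∧ ∀ z ∈ V, L₁ z = L₂ z + c := by
    rcases V.eq_empty_or_nonempty with rfl | ⟨v, hv⟩
    · exact ⟨0, by simp⟩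
    have hexp : ∀ z ∈ V, Complex.exp (L₁ z - L₂ z) = 1 := by
      intro z hz
      have h1 := hL₁ z (hVp hz)
      have h2 := hL₂ z (hVT hz)
      have hzb : z - b ≠ 0 := fun e => hbp (sub_eq_zero.1 e ▸ hVp hz)
      rw [Complex.exp_sub, mul_right_cancel₀ hzb (h1.trans h2.symm),
        div_self (Complex.exp_ne_zero _)]
    refine ⟨L₁ v - L₂ v, hexp v hv, fun z hz => ?_⟩
    have hcont : ContinuousOn (fun z => ((L₁ z - L₂ z) / (2 * Real.pi * Complex.I)).re) V :=
      Complex.continuous_re.comp_continuousOn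
        (((hc₁.mono hVp).sub (hc₂.mono hVT)).div_const _)
    have hint : ∀ z ∈ V, ∃ n : ℤ, L₁ z - L₂ z = n * (2 * Real.pi * Complex.I) := fun z hz =>
      Complex.exp_eq_one_iff.1 (hexp z hz)
    have h2pi : (2 * Real.pi * Complex.I : ℂ) ≠ 0 := by simp [Real.pi_ne_zero]
    obtain ⟨n, hn⟩ := hint z hz
    obtain ⟨m, hm⟩ := hint v hv
    have himg := hV.image _ hcont
    have hnm : n = m := by
      by_contra hne
      have h1 : (n : ℝ) ∈ (fun z => ((L₁ z - L₂ z) / (2 * Real.pi * Complex.I)).re) '' V :=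
        ⟨z, hz, by simp only [hn]; rw [mul_div_cancel_right₀ _ h2pi]; simp⟩
      have h2 : (m : ℝ) ∈ (fun z => ((L₁ z - L₂ z) / (2 * Real.pi * Complex.I)).re) '' V :=
        ⟨v, hv, by simp only [hm]; rw [mul_div_cancel_right₀ _ h2pi]; simp⟩
      have key : ∀ i j : ℤ, i < j →
          (i : ℝ) ∈ (fun z => ((L₁ z - L₂ z) / (2 * Real.pi * Complex.I)).re) '' V →
          (j : ℝ) ∈ (fun z => ((L₁ z - L₂ z) / (2 * Real.pi * Complex.I)).re) '' V → False := by
        intro i j hij hi hj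
        have hij' : (i : ℝ) + 1 ≤ j := by exact_mod_cast hij
        obtain ⟨y, hy, hye⟩ := himg.ordConnected.out hi hj
          (⟨by linarith, by linarith⟩ : (i : ℝ) + 1 / 2 ∈ Icc (i : ℝ) j)
        obtain ⟨k, hk⟩ := hint y hy
        simp only [hk] at hye
        rw [mul_div_cancel_right₀ _ h2pi, Complex.intCast_re] at hye
        have h3 : (2 * k : ℝ) = 2 * i + 1 := by linarith
        have h4 : 2 * k = 2 * i + 1 := by exact_mod_cast h3
        omega
      rcases lt_or_gt_of_ne hne with h | h
      · exact key _ _ h h1 h2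
      · exact key _ _ h h2 h1
    rw [hm, ← hnm, ← hn]
    ring
  obtain ⟨c, hc, hcV⟩ := hconst
  -- After the shift by `c` the logarithms agree on `C ∩ Tᶜ ⊆ V`, so they glue to one on the closed
  -- set `C ∪ Tᶜ`, which contains the frontier of `U`.
  let L : ℂ → ℂ := fun z => if z ∈ C then L₁ z else L₂ z + c
  have hLC : EqOn L L₁ C := fun z hz => if_pos hz
  have hLT : EqOn L (fun z => L₂ z + c) Tᶜ := by
    intro z hz
    by_cases hzC : z ∈ C
    · rw [hLC hzC]
      exact hcV z (hCV ⟨hzC, hz⟩)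
    · exact if_neg hzC
  have hcont : ContinuousOn L (C ∪ Tᶜ) :=
    ContinuousOn.union_of_isClosed ((hc₁.mono hCp).congr hLC)
      ((hc₂.add continuousOn_const).congr hLT) hC hT.isClosed_compl
  refine mem_of_log_on_frontier hUb ha (hcont.mono hfr) fun z hz => ?_
  rcases hfr hz with h | h
  · rw [hLC h]
    exact hL₁ z (hCp h)
  · rw [hLT h]
    simp only []
    rw [Complex.exp_add, hc, mul_one]
    exact hL₂ z h

/-! ### The inverse of a conformal isomorphism, and the Schwarz-Pick estimate -/

theorem isOpen_rightHalfPlane : IsOpen rightHalfPlane :=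
  isOpen_lt continuous_const Complex.continuous_re

/-- The inverse of an injective holomorphic function is holomorphic. -/
theorem differentiableOn_invFunOn {T : Set ℂ} (hT : IsOpen T) {F : ℂ → ℂ}
    (hF : DifferentiableOn ℂ F T) (hinj : InjOn F T) :
    DifferentiableOn ℂ (Function.invFunOn F T) (F '' T) := by
  set G := Function.invFunOn F T with hG
  have hGF : ∀ z ∈ T, G (F z) = z := fun z hz => hinj.leftInvOn_invFunOn hz
  have hFG : ∀ w ∈ F '' T, F (G w) = w := fun w hw => Function.invFunOn_eq hw
  have hGT : ∀ w ∈ F '' T, G w ∈ T := fun w hw => Function.invFunOn_mem hw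
  have han : ∀ z ∈ T, AnalyticAt ℂ F z := fun z hz => hF.analyticAt (hT.mem_nhds hz)
  have hnc : ∀ z ∈ T, ¬ ∀ᶠ y in 𝓝 z, F y = F z := by
    intro z hz h
    have h1 : ∀ᶠ y in 𝓝[≠] z, F y = F z ∧ y ∈ T :=
      (h.and (hT.mem_nhds hz)).filter_mono nhdsWithin_le_nhds
    obtain ⟨y, ⟨hy1, hy2⟩, hy3⟩ := (h1.and self_mem_nhdsWithin).exists
    exact hy3 (hinj hy2 hz hy1)
  have hmap : ∀ z ∈ T, 𝓝 (F z) ≤ map F (𝓝 z) := fun z hz =>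
    ((han z hz).eventually_constant_or_nhds_le_map_nhds).resolve_left (hnc z hz)
  have hcont : ∀ z ∈ T, Tendsto G (𝓝 (F z)) (𝓝 z) := by
    intro z hz s hs
    have h1 : F '' (s ∩ T) ∈ 𝓝 (F z) :=
      hmap z hz (image_mem_map (inter_mem hs (hT.mem_nhds hz)))
    refine mem_map.2 (mem_of_superset h1 ?_)
    rintro _ ⟨y, hy, rfl⟩
    rw [mem_preimage, hGF y hy.2]
    exact hy.1
  have hnhds : ∀ z ∈ T, F '' T ∈ 𝓝 (F z) := fun z hz =>
    hmap z hz (image_mem_map (hT.mem_nhds hz))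
  have hreg : ∀ z ∈ T, deriv F z ≠ 0 → DifferentiableAt ℂ G (F z) := by
    intro z hz hd
    have h1 : HasDerivAt F (deriv F z) (G (F z)) := by
      rw [hGF z hz]
      exact (han z hz).differentiableAt.hasDerivAt
    refine (HasDerivAt.of_local_left_inverse (f := F) (g := G) (a := F z) ?_ h1 hd
      ?_).differentiableAt
    · rw [ContinuousAt, hGF z hz]
      exact hcont z hz
    · filter_upwards [hnhds z hz] with w hw using hFG w hw
  rintro _ ⟨z, hz, rfl⟩
  refine DifferentiableAt.differentiableWithinAt ?_
  -- Zeros of `F'` are isolated, since otherwise `F` would be locally constant. At their images the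
  -- continuous map `G` has a removable singularity, so `F' ≠ 0` need not be shown.
  have hder : ∀ᶠ y in 𝓝[≠] z, deriv F y ≠ 0 := by
    refine ((han z hz).deriv.eventually_eq_zero_or_eventually_ne_zero).resolve_left fun h => ?_
    obtain ⟨r, hr, hball⟩ := Metric.eventually_nhds_iff_ball.1 (h.and (hT.mem_nhds hz))
    refine hnc z hz ?_
    filter_upwards [Metric.ball_mem_nhds z hr] with y hy
    exact (convex_ball z r).is_const_of_fderivWithin_eq_zero (𝕜 := ℂ) (f := F)
      (fun x hx => (han x (hball x hx).2).differentiableAt.differentiableWithinAt)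
      (fun x hx => by
        rw [fderivWithin_of_isOpen Metric.isOpen_ball hx]
        ext
        simpa using (hball x hx).1) hy (Metric.mem_ball_self hr)
  refine (Complex.analyticAt_of_differentiable_on_punctured_nhds_of_continuousAt ?_
    ?_).differentiableAt
  · have h1 : Tendsto G (𝓝[≠] (F z)) (𝓝[≠] z) := by
      refine tendsto_nhdsWithin_iff.2 ⟨(hcont z hz).mono_left nhdsWithin_le_nhds, ?_⟩
      filter_upwards [self_mem_nhdsWithin, nhdsWithin_le_nhds (hnhds z hz)] with w hw hwT e
      exact hw (by rw [mem_singleton_iff, ← hFG w hwT, mem_singleton_iff.1 e])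
    filter_upwards [h1.eventually hder, nhdsWithin_le_nhds (hnhds z hz)] with w hw hwT
    have := hreg (G w) (hGT w hwT) hw
    rwa [hFG w hwT] at this
  · rw [ContinuousAt, hGF z hz]
    exact hcont z hz

/-- The Schwarz-Pick lemma for the right half-plane. -/
theorem norm_deriv_mul_re_le {g : ℂ → ℂ} (hd : DifferentiableOn ℂ g rightHalfPlane)
    (hm : MapsTo g rightHalfPlane rightHalfPlane) {w : ℂ} (hw : w ∈ rightHalfPlane) :
    ‖deriv g w‖ * w.re ≤ (g w).re := by
  have hw' : 0 < w.re := hw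
  have hg0 : 0 < (g w).re := hm hw
  -- `c` maps the disc to `ℍ` with `c 0 = w`; `k` is `g ∘ c` followed by the Cayley map sending `g
  -- w` to `0`. The Schwarz lemma for `k` at `0` is the claim.
  let c : ℂ → ℂ := fun ζ => (w + starRingEnd ℂ w * ζ) / (1 - ζ)
  let k : ℂ → ℂ := fun ζ => (g (c ζ) - g w) / (g (c ζ) + starRingEnd ℂ (g w))
  have hne : ∀ ζ ∈ Metric.ball (0 : ℂ) 1, 1 - ζ ≠ 0 := by
    intro ζ hζ e
    rw [← sub_eq_zero.1 e] at hζ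
    simp at hζ
  have hc : MapsTo c (Metric.ball 0 1) rightHalfPlane := by
    intro ζ hζ
    have h1 : ‖ζ‖ < 1 := by simpa using hζ
    have h2 : Complex.normSq ζ < 1 := by
      rw [Complex.normSq_eq_norm_sq]
      nlinarith [norm_nonneg ζ]
    have h3 : 0 < Complex.normSq (1 - ζ) := Complex.normSq_pos.2 (hne ζ hζ)
    have h4 : (c ζ).re = w.re * (1 - Complex.normSq ζ) / Complex.normSq (1 - ζ) := by
      simp only [c, Complex.div_re]
      rw [← add_div]
      congr 1
      simp [Complex.normSq_apply]
      ring
    change 0 < (c ζ).re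
    rw [h4]
    exact div_pos (mul_pos hw' (by linarith)) h3
  have hcd : DifferentiableOn ℂ c (Metric.ball 0 1) :=
    DifferentiableOn.div (by fun_prop) (by fun_prop) hne
  have hden : ∀ x ∈ rightHalfPlane, x + starRingEnd ℂ (g w) ≠ 0 := by
    intro x hx e
    have hx' : 0 < x.re := hx
    have := congrArg Complex.re e
    simp at this
    linarith
  have hkd : DifferentiableOn ℂ k (Metric.ball 0 1) :=
    DifferentiableOn.div ((hd.comp hcd hc).sub_const _) ((hd.comp hcd hc).add_const _)
      fun ζ hζ => hden _ (hm (hc hζ))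
  have hk0 : k 0 = 0 := by simp [k, c]
  have hkm : MapsTo k (Metric.ball 0 1) (Metric.ball (k 0) 1) := by
    intro ζ hζ
    have hx : 0 < (g (c ζ)).re := hm (hc hζ)
    rw [hk0, Metric.mem_ball, dist_zero_right]
    simp only [k]
    rw [norm_div, div_lt_one (norm_pos_iff.2 (hden _ (hm (hc hζ))))]
    rw [← sq_lt_sq₀ (norm_nonneg _) (norm_nonneg _), ← Complex.normSq_eq_norm_sq,
      ← Complex.normSq_eq_norm_sq, Complex.normSq_apply, Complex.normSq_apply]
    simp only [Complex.sub_re, Complex.sub_im, Complex.add_re, Complex.add_im, Complex.conj_re,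
      Complex.conj_im]
    nlinarith [mul_pos hx hg0]
  have hle := Complex.norm_deriv_le_one_of_mapsTo_ball hkd 
    (hkm.mono_right Metric.ball_subset_closedBall) one_pos
  have hc0 : c 0 = w := by simp [c]
  have hcder : HasDerivAt c (w + starRingEnd ℂ w) 0 := by
    have h1 : HasDerivAt (fun ζ : ℂ => w + starRingEnd ℂ w * ζ) (starRingEnd ℂ w) 0 := by
      simpa using ((hasDerivAt_id (0 : ℂ)).const_mul (starRingEnd ℂ w)).const_add w
    have h2 : HasDerivAt (fun ζ : ℂ => 1 - ζ) (-1) 0 := by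
      simpa using (hasDerivAt_id (0 : ℂ)).const_sub 1
    refine (h1.div h2 (by simp)).congr_deriv ?_
    simp
    ring
  have hgder : HasDerivAt g (deriv g w) (c 0) := by
    rw [hc0]
    exact (hd.differentiableAt (isOpen_rightHalfPlane.mem_nhds hw)).hasDerivAt
  have hgc : HasDerivAt (fun ζ => g (c ζ)) (deriv g w * (w + starRingEnd ℂ w)) 0 :=
    hgder.comp 0 hcder
  have hkder := ((hgc.sub_const (g w)).div (hgc.add_const (starRingEnd ℂ (g w)))
    (by simpa [hc0] using hden _ (hm hw))).deriv
  have hk' : deriv k 0 = deriv g w * (w + starRingEnd ℂ w) / (g w + starRingEnd ℂ (g w)) := by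
    refine hkder.trans ?_
    rw [hc0, sub_self, zero_mul, sub_zero]
    have := hden _ (hm hw)
    field_simp
  rw [hk', norm_div, norm_mul, Complex.add_conj, Complex.add_conj, Complex.norm_real,
    Complex.norm_real, Real.norm_of_nonneg (by linarith), Real.norm_of_nonneg (by linarith),
    div_le_one (by linarith)] at hle
  linarith

/-- `exp (G / 2)` maps `ℍ` into `ℍ`. In the Schwarz-Pick inequality for it, the factor `|exp (G w /
2)|` appears on the left and bounds the real part on the right, so it cancels. -/
theorem norm_deriv_le_of_abs_im_lt {G : ℂ → ℂ} (hd : DifferentiableOn ℂ G rightHalfPlane)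
    (hm : ∀ w ∈ rightHalfPlane, |(G w).im| < Real.pi) {w : ℂ} (hw : w ∈ rightHalfPlane) :
    ‖deriv G w‖ ≤ 2 / w.re := by
  have hw' : 0 < w.re := hw
  have hG := (hd.differentiableAt (isOpen_rightHalfPlane.mem_nhds hw)).hasDerivAt
  have hg : HasDerivAt (fun z => Complex.exp (G z / 2)) (Complex.exp (G w / 2) * (deriv G w / 2))
      w := (hG.div_const 2).cexp
  have h := norm_deriv_mul_re_le (g := fun z => Complex.exp (G z / 2)) ((hd.div_const 2).cexp)
    (fun z hz => by
      change 0 < (Complex.exp (G z / 2)).re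
      rw [Complex.exp_re]
      have h1 := abs_lt.1 (hm z hz)
      refine mul_pos (Real.exp_pos _) (Real.cos_pos_of_mem_Ioo ?_)
      constructor <;> simp <;> linarith) hw
  rw [hg.deriv, norm_mul, norm_div] at h
  have h2 := (Complex.re_le_norm (Complex.exp (G w / 2)))
  have h3 : 0 < ‖Complex.exp (G w / 2)‖ := norm_pos_iff.2 (Complex.exp_ne_zero _)
  rw [le_div_iff₀ hw']
  have h4 : ‖(2 : ℂ)‖ = 2 := by simp
  rw [h4] at h
  have h5 := h.trans h2
  have : ‖Complex.exp (G w / 2)‖ * (‖deriv G w‖ * w.re) ≤ ‖Complex.exp (G w / 2)‖ * 2 := by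
    nlinarith
  exact le_of_mul_le_mul_left this h3

/-! ### Basic estimates for the inverse `G = F⁻¹ : ℍ → T` -/

/-- The inverse `F⁻¹ : ℍ → T` of `F : T → ℍ`. -/
def inverseMap (T : Set ℂ) (F : ℂ → ℂ) : ℂ → ℂ := Function.invFunOn F T

theorem oneDimProjection_eq (T : Set ℂ) (F : ℂ → ℂ) (t : ℝ) :
    oneDimProjection T F t = (inverseMap T F t).re := rfl

theorem ofReal_mem_rightHalfPlane {t : ℝ} : (t : ℂ) ∈ rightHalfPlane ↔ 0 < t := by
  simp [rightHalfPlane]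

theorem norm_pos_of_mem_rightHalfPlane {w : ℂ} (hw : w ∈ rightHalfPlane) : 0 < ‖w‖ :=
  lt_of_lt_of_le hw (Complex.re_le_norm w)

section ClassH

variable {T : Set ℂ} {F : ℂ → ℂ}

theorem ClassH.inverseMap_mem (hF : ClassH T F) {w : ℂ} (hw : w ∈ rightHalfPlane) :
    inverseMap T F w ∈ T :=
  Function.invFunOn_mem (hF.bijOn.surjOn hw)

theorem ClassH.map_inverseMap (hF : ClassH T F) {w : ℂ} (hw : w ∈ rightHalfPlane) :
    F (inverseMap T F w) = w :=
  Function.invFunOn_eq (hF.bijOn.surjOn hw)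

theorem ClassH.inverseMap_map (hF : ClassH T F) {z : ℂ} (hz : z ∈ T) :
    inverseMap T F (F z) = z :=
  hF.bijOn.injOn.leftInvOn_invFunOn hz

theorem ClassH.injOn_inverseMap (hF : ClassH T F) : InjOn (inverseMap T F) rightHalfPlane := by
  intro x hx y hy h
  rw [← hF.map_inverseMap hx, h, hF.map_inverseMap hy]

theorem ClassH.differentiableOn_inverseMap (hF : ClassH T F) :
    DifferentiableOn ℂ (inverseMap T F) rightHalfPlane := by
  rw [← hF.bijOn.image_eq]
  exact differentiableOn_invFunOn hF.isTract.isOpen hF.differentiableOn hF.bijOn.injOn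

theorem ClassH.four_lt_re_inverseMap (hF : ClassH T F) {w : ℂ} (hw : w ∈ rightHalfPlane) :
    4 < (inverseMap T F w).re :=
  (hF.isTract.subset_halfStrip (hF.inverseMap_mem hw)).1

theorem ClassH.abs_im_inverseMap_lt (hF : ClassH T F) {w : ℂ} (hw : w ∈ rightHalfPlane) :
    |(inverseMap T F w).im| < Real.pi :=
  (hF.isTract.subset_halfStrip (hF.inverseMap_mem hw)).2

theorem ClassH.norm_deriv_inverseMap_le (hF : ClassH T F) {w : ℂ} (hw : w ∈ rightHalfPlane) :
    ‖deriv (inverseMap T F) w‖ ≤ 2 / w.re :=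
  norm_deriv_le_of_abs_im_lt hF.differentiableOn_inverseMap
    (fun _ h => hF.abs_im_inverseMap_lt h) hw

/-- `F⁻¹` contracts distances by a factor of two on `{Re z ≥ 4}`. -/
theorem ClassH.norm_inverseMap_sub_le (hF : ClassH T F) {w w' : ℂ} (hw : 4 ≤ w.re)
    (hw' : 4 ≤ w'.re) : ‖inverseMap T F w - inverseMap T F w'‖ ≤ 1 / 2 * ‖w - w'‖ := by
  have hsub : ∀ z : ℂ, 4 ≤ z.re → z ∈ rightHalfPlane := fun z hz => by
    change 0 < z.re
    linarith
  refine (convex_halfSpace_re_ge 4).norm_image_sub_le_of_norm_deriv_le (𝕜 := ℂ)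
    (f := inverseMap T F) (fun z hz => ?_) (fun z hz => ?_) hw' hw
  · exact hF.differentiableOn_inverseMap.differentiableAt
      (isOpen_rightHalfPlane.mem_nhds (hsub z hz))
  · refine (hF.norm_deriv_inverseMap_le (hsub z hz)).trans ?_
    have : 4 ≤ z.re := hz
    rw [div_le_iff₀ (by linarith)]
    linarith

/-- In the coordinate `log t` the bound `2 / Re w` on the derivative becomes the constant `2`.
Bounded ratios of moduli thus cost only bounded errors. -/
theorem ClassH.norm_inverseMap_ofReal_sub_le (hF : ClassH T F) {x y : ℝ} (hx : 0 < x)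
    (hy : 0 < y) :
    ‖inverseMap T F x - inverseMap T F y‖ ≤ 2 * |Real.log x - Real.log y| := by
  have key := (convex_univ : Convex ℝ (univ : Set ℝ)).norm_image_sub_le_of_norm_hasDerivWithin_le
    (f := fun s : ℝ => inverseMap T F (Real.exp s : ℝ))
    (f' := fun s : ℝ => deriv (inverseMap T F) (Real.exp s : ℝ) * (Real.exp s : ℝ)) (C := 2)
    (x := Real.log y) (y := Real.log x)
    (fun s _ => by
      have h1 := (hF.differentiableOn_inverseMap.differentiableAt (isOpen_rightHalfPlane.mem_nhds
        (ofReal_mem_rightHalfPlane.2 (Real.exp_pos s)))).hasDerivAt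
      exact (h1.comp s (Real.hasDerivAt_exp s).ofReal_comp).hasDerivWithinAt)
    (fun s _ => by
      have h1 := hF.norm_deriv_inverseMap_le (ofReal_mem_rightHalfPlane.2 (Real.exp_pos s))
      rw [norm_mul, Complex.norm_real, Real.norm_of_nonneg (Real.exp_pos s).le]
      rw [Complex.ofReal_re, le_div_iff₀ (Real.exp_pos s)] at h1
      exact h1) (mem_univ _) (mem_univ _)
  simpa [Real.exp_log hx, Real.exp_log hy] using key

theorem ClassH.abs_oneDimProjection_sub_le (hF : ClassH T F) {x y : ℝ} (hx : 0 < x)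
    (hy : 0 < y) :
    |oneDimProjection T F x - oneDimProjection T F y| ≤ 2 * |Real.log x - Real.log y| := by
  rw [oneDimProjection_eq, oneDimProjection_eq, ← Complex.sub_re]
  exact (Complex.abs_re_le_norm _).trans (hF.norm_inverseMap_ofReal_sub_le hx hy)

theorem ClassH.continuousOn_oneDimProjection (hF : ClassH T F) :
    ContinuousOn (oneDimProjection T F) (Ioi 0) :=
  Complex.continuous_re.comp_continuousOn
    (hF.differentiableOn_inverseMap.continuousOn.comp Complex.continuous_ofReal.continuousOn
      fun _ ht => ofReal_mem_rightHalfPlane.2 ht)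

theorem ClassH.isBounded_sublevel (hF : ClassH T F) (R : ℝ) :
    IsBounded (T ∩ F ⁻¹' Metric.ball 0 R) := by
  have h1 := hF.tendsto_infty
    (isBounded_def.1 (Metric.isBounded_ball (x := (0 : ℂ)) (r := R)))
  rw [mem_map, mem_inf_principal] at h1
  have h2 := isBounded_compl_iff.2 h1
  refine h2.subset fun z hz h3 => h3 hz.1 hz.2

/-- `T` is unbounded, but `{|F| < R + 1}` is bounded and imaginary parts in `T` are bounded; so real
parts are unbounded on the rest. -/
theorem ClassH.exists_lt_re_inverseMap (hF : ClassH T F) (R M : ℝ) :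
    ∃ w ∈ rightHalfPlane, R < ‖w‖ ∧ M < (inverseMap T F w).re := by
  by_contra! hcon
  refine hF.isTract.unbounded ?_
  have h1 : T ⊆ (T ∩ F ⁻¹' Metric.ball 0 (R + 1)) ∪ Metric.ball 0 (M + Real.pi + 1) := by
    intro z hz
    by_cases h : ‖F z‖ < R + 1
    · exact Or.inl ⟨hz, by simpa using h⟩
    · right
      have h2 := hcon (F z) (hF.bijOn.mapsTo hz) (by linarith)
      rw [hF.inverseMap_map hz] at h2
      have h3 := hF.isTract.subset_halfStrip hz
      have h4 := Complex.norm_le_abs_re_add_abs_im z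
      rw [abs_of_pos (by linarith [h3.1] : 0 < z.re)] at h4
      simp only [mem_ball_zero_iff]
      linarith [h3.2]
  exact ((hF.isBounded_sublevel _).union Metric.isBounded_ball).subset h1

end ClassH

/-- The points `w` and `|w|` lie on the same semicircle. This reduces `G` on all of `ℍ` to its
values on the real axis, up to `ν`. -/
theorem ClassHnu.norm_inverseMap_sub_le_nu {ν : ℝ} {T : Set ℂ} {F : ℂ → ℂ}
    (hF : ClassHnu ν T F) (hν : 0 ≤ ν) {w : ℂ} (hw : w ∈ rightHalfPlane) :
    ‖inverseMap T F w - inverseMap T F (‖w‖ : ℝ)‖ ≤ ν := by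
  have hpos := norm_pos_of_mem_rightHalfPlane hw
  have hw' : ((‖w‖ : ℝ) : ℂ) ∈ rightHalfPlane := ofReal_mem_rightHalfPlane.2 hpos
  have h := (Metric.edist_le_ediam_of_mem (x := inverseMap T F w) (y := inverseMap T F (‖w‖ : ℝ))
    (s := T ∩ F ⁻¹' {z ∈ rightHalfPlane | ‖z‖ = ‖w‖})
    ⟨hF.inverseMap_mem hw, by rw [mem_preimage, hF.map_inverseMap hw]; exact ⟨hw, rfl⟩⟩
    ⟨hF.inverseMap_mem hw', by
      rw [mem_preimage, hF.map_inverseMap hw']; exact ⟨hw', by simp⟩⟩).trans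
    (hF.ediam_le _ hpos)
  rw [edist_dist, dist_eq_norm] at h
  exact (ENNReal.ofReal_le_ofReal_iff hν).1 h

/-! ### The length-area method -/

open MeasureTheory in
/-- If the image of the rectangle `(s₀, s₀ + 1) × (-π/2, π/2)` under an injective holomorphic map
has small area, then some vertical cross-section has an image of small diameter. -/
theorem exists_short_crosscut {E : ℂ → ℂ} {s₀ η : ℝ} (hη : 0 < η)
    (hd : DifferentiableOn ℂ E {z | |z.im| < Real.pi / 2})
    (hinj : InjOn E {z | |z.im| < Real.pi / 2})
    (harea : volume (E '' (Ioo s₀ (s₀ + 1) ×ℂ Ioo (-(Real.pi / 2)) (Real.pi / 2))) ≤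
      ENNReal.ofReal (η ^ 2)) :
    ∃ s ∈ Ioo s₀ (s₀ + 1), ∀ θ₁ θ₂ : ℝ, |θ₁| < Real.pi / 2 → |θ₂| < Real.pi / 2 →
      ‖E (s + θ₁ * Complex.I) - E (s + θ₂ * Complex.I)‖ ≤ 3 * η := by
  set S : Set ℂ := {z | |z.im| < Real.pi / 2} with hS
  have hSo : IsOpen S := isOpen_lt (by fun_prop) continuous_const
  set B : Set ℂ := Ioo s₀ (s₀ + 1) ×ℂ Ioo (-(Real.pi / 2)) (Real.pi / 2) with hB
  have hBS : B ⊆ S := fun z hz => abs_lt.2 ⟨hz.2.1, hz.2.2⟩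
  have hBm : MeasurableSet B := (isOpen_Ioo.reProdIm isOpen_Ioo).measurableSet
  have hder : ∀ z ∈ S, HasDerivAt E (deriv E z) z := fun z hz =>
    (hd.differentiableAt (hSo.mem_nhds hz)).hasDerivAt
  have h1 := lintegral_abs_det_fderiv_eq_addHaar_image volume hBm
    (f := E) (f' := fun z => (ContinuousLinearMap.toSpanSingleton ℂ (deriv E z)).restrictScalars ℝ)
    (fun z hz => ((hder z (hBS hz)).hasFDerivAt.restrictScalars ℝ).hasFDerivWithinAt)
    (hinj.mono hBS)
  have h2 : ∫⁻ z in B, ‖deriv E z‖ₑ ^ 2 ≤ ENNReal.ofReal (η ^ 2) := by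
    refine le_trans (le_of_eq ?_) (h1.le.trans harea)
    congr 1
    ext z
    simp [ContinuousLinearMap.det, LinearMap.det_restrictScalars, Algebra.norm_complex_eq,
      Complex.normSq_eq_norm_sq, ENNReal.ofReal_pow]
  have hmeas : Measurable fun z => ‖deriv E z‖ₑ ^ 2 := (measurable_deriv E).enorm.pow_const 2
  have h3 : ∫⁻ s in Ioo s₀ (s₀ + 1), ∫⁻ θ in Ioo (-(Real.pi / 2)) (Real.pi / 2),
      ‖deriv E ⟨s, θ⟩‖ₑ ^ 2 ≤ ENNReal.ofReal (η ^ 2) := by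
    refine le_trans (le_of_eq ?_) h2
    rw [← Complex.volume_preserving_equiv_real_prod.symm.setLIntegral_comp_preimage_emb
      Complex.measurableEquivRealProd.symm.measurableEmbedding _ B]
    have hpre : Complex.measurableEquivRealProd.symm ⁻¹' B =
        Ioo s₀ (s₀ + 1) ×ˢ Ioo (-(Real.pi / 2)) (Real.pi / 2) := rfl
    rw [hpre, Measure.volume_eq_prod, setLIntegral_prod]
    · rfl
    · exact (hmeas.comp Complex.measurableEquivRealProd.symm.measurable).aemeasurable
  -- The mean over an interval of length `1` is at most `η²`, so some cross-section has integral at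
  -- most `2η²`; the factor `2` makes the contradiction strict.
  obtain ⟨s, hs, hsI⟩ : ∃ s ∈ Ioo s₀ (s₀ + 1), ∫⁻ θ in Ioo (-(Real.pi / 2)) (Real.pi / 2),
      ‖deriv E ⟨s, θ⟩‖ₑ ^ 2 ≤ ENNReal.ofReal (2 * η ^ 2) := by
    by_contra! hcon
    have h4 := (setLIntegral_mono' (measurableSet_Ioo (a := s₀) (b := s₀ + 1))
      (μ := volume) fun s hs => (hcon s hs).le).trans h3
    rw [setLIntegral_const, Real.volume_Ioo, add_sub_cancel_left, ENNReal.ofReal_one, mul_one,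
      ENNReal.ofReal_le_ofReal_iff (by positivity)] at h4
    nlinarith [sq_pos_of_pos hη]
  refine ⟨s, hs, ?_⟩
  have key : ∀ θ₁ θ₂ : ℝ, |θ₁| < Real.pi / 2 → |θ₂| < Real.pi / 2 → θ₂ ≤ θ₁ →
      ‖E (s + θ₁ * Complex.I) - E (s + θ₂ * Complex.I)‖ ≤ 3 * η := by
    intro θ₁ θ₂ h1 h2 h12
    have hsub : Icc θ₂ θ₁ ⊆ Ioo (-(Real.pi / 2)) (Real.pi / 2) := fun θ hθ =>
      ⟨by linarith [(abs_lt.1 h2).1, hθ.1], by linarith [(abs_lt.1 h1).2, hθ.2]⟩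
    have hmem : ∀ θ ∈ Icc θ₂ θ₁, (s + θ * Complex.I : ℂ) ∈ S := fun θ hθ => by
      have := hsub hθ
      simpa [hS] using abs_lt.2 ⟨this.1, this.2⟩
    have hderθ : ∀ θ ∈ uIcc θ₂ θ₁, HasDerivAt (fun θ : ℝ => E (s + θ * Complex.I))
        (deriv E (s + θ * Complex.I) * Complex.I) θ := by
      intro θ hθ
      rw [uIcc_of_le h12] at hθ
      have h5 : HasDerivAt (fun θ : ℝ => (s + θ * Complex.I : ℂ)) Complex.I θ := by
        simpa using ((hasDerivAt_id θ).ofReal_comp.mul_const Complex.I).const_add (s : ℂ)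
      exact (hder _ (hmem θ hθ)).comp θ h5
    have hcont : ContinuousOn (fun θ : ℝ => deriv E (s + θ * Complex.I) * Complex.I)
        (uIcc θ₂ θ₁) := by
      rw [uIcc_of_le h12]
      exact (((hd.deriv hSo).continuousOn.comp (by fun_prop) hmem)).mul continuousOn_const
    have hFTC := intervalIntegral.integral_eq_sub_of_hasDerivAt hderθ
      hcont.intervalIntegrable
    -- The inequality `|x| ≤ η/2 + |x|²/(2η)` does the work of Cauchy-Schwarz. Integrated over
    -- length `π` it gives `πη/2 + η ≤ 3η`.
    have hpt : ∀ x : ℂ, ‖x * Complex.I‖ₑ ≤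
        ENNReal.ofReal (η / 2) + ENNReal.ofReal (1 / (2 * η)) * ‖x‖ₑ ^ 2 := by
      intro x
      rw [← ofReal_norm, ← ofReal_norm, ← ENNReal.ofReal_pow (norm_nonneg _),
        ← ENNReal.ofReal_mul (by positivity), ← ENNReal.ofReal_add (by positivity) (by positivity)]
      refine ENNReal.ofReal_le_ofReal ?_
      rw [norm_mul, Complex.norm_I, mul_one]
      have : η / 2 + 1 / (2 * η) * ‖x‖ ^ 2 - ‖x‖ = (η - ‖x‖) ^ 2 / (2 * η) := by
        field_simp
        ring
      have h6 : 0 ≤ (η - ‖x‖) ^ 2 / (2 * η) := by positivity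
      linarith
    have hle : ‖E (s + θ₁ * Complex.I) - E (s + θ₂ * Complex.I)‖ₑ ≤ ENNReal.ofReal (3 * η) := by
      rw [← hFTC, intervalIntegral.integral_of_le h12]
      calc ‖∫ θ in Ioc θ₂ θ₁, deriv E (s + θ * Complex.I) * Complex.I‖ₑ
          ≤ ∫⁻ θ in Ioc θ₂ θ₁, ‖deriv E (s + θ * Complex.I) * Complex.I‖ₑ :=
            enorm_integral_le_lintegral_enorm _
        _ ≤ ∫⁻ θ in Ioc θ₂ θ₁, (ENNReal.ofReal (η / 2) + ENNReal.ofReal (1 / (2 * η)) *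
              ‖deriv E ⟨s, θ⟩‖ₑ ^ 2) := by
            refine lintegral_mono fun θ => ?_
            have : (s + θ * Complex.I : ℂ) = ⟨s, θ⟩ := by
              rw [Complex.mk_eq_add_mul_I]
            rw [this]
            exact hpt _
        _ ≤ ∫⁻ θ in Ioo (-(Real.pi / 2)) (Real.pi / 2), (ENNReal.ofReal (η / 2) +
              ENNReal.ofReal (1 / (2 * η)) * ‖deriv E ⟨s, θ⟩‖ₑ ^ 2) :=
            lintegral_mono_set (Ioc_subset_Icc_self.trans hsub)
        _ = ENNReal.ofReal (η / 2) * ENNReal.ofReal Real.pi + ENNReal.ofReal (1 / (2 * η)) *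
              ∫⁻ θ in Ioo (-(Real.pi / 2)) (Real.pi / 2), ‖deriv E ⟨s, θ⟩‖ₑ ^ 2 := by
            rw [lintegral_add_left measurable_const, setLIntegral_const, Real.volume_Ioo,
              lintegral_const_mul' _ _ ENNReal.ofReal_ne_top]
            congr 3
            ring
        _ ≤ ENNReal.ofReal (η / 2) * ENNReal.ofReal Real.pi + ENNReal.ofReal (1 / (2 * η)) *
              ENNReal.ofReal (2 * η ^ 2) := by gcongr
        _ = ENNReal.ofReal (η / 2 * Real.pi + 1 / (2 * η) * (2 * η ^ 2)) := by
            rw [ENNReal.ofReal_add (by positivity) (by positivity),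
              ENNReal.ofReal_mul (p := η / 2) (by positivity),
              ENNReal.ofReal_mul (p := 1 / (2 * η)) (by positivity)]
        _ ≤ ENNReal.ofReal (3 * η) := by
            refine ENNReal.ofReal_le_ofReal ?_
            have : 1 / (2 * η) * (2 * η ^ 2) = η := by field_simp
            rw [this]
            nlinarith [Real.pi_lt_four]
    rwa [← ofReal_norm, ENNReal.ofReal_le_ofReal_iff (by positivity)] at hle
  intro θ₁ θ₂ h1 h2
  rcases le_total θ₂ θ₁ with h | h
  · exact key θ₁ θ₂ h1 h2 h
  · rw [norm_sub_rev]
    exact key θ₂ θ₁ h2 h1 h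

/-! ### `F⁻¹(t) → ∞` as `t → ∞` -/

theorem exp_mem_rightHalfPlane {z : ℂ} (hz : |z.im| < Real.pi / 2) :
    Complex.exp z ∈ rightHalfPlane := by
  change 0 < (Complex.exp z).re
  rw [Complex.exp_re]
  exact mul_pos (Real.exp_pos _) (Real.cos_pos_of_mem_Ioo (abs_lt.1 hz))

section

variable {ν : ℝ} {T : Set ℂ} {F : ℂ → ℂ}

open MeasureTheory in
/-- If `φ` stays bounded along a sequence tending to infinity, then arbitrarily far out there are
semicircles whose images under `F⁻¹` are small and stay in a bounded set. -/
theorem ClassHnu.exists_small_crosscut (hF : ClassHnu ν T F) (hν : 0 ≤ ν) {M : ℝ}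
    (hM : ∀ R : ℝ, ∃ t ≥ R, oneDimProjection T F t < M) {η : ℝ} (hη : 0 < η) (R₀ : ℝ) :
    ∃ r > R₀, 0 < r ∧ ‖inverseMap T F r‖ ≤ M + Real.pi + 2 ∧
      ∀ w ∈ rightHalfPlane, ‖w‖ = r → ‖inverseMap T F w - inverseMap T F r‖ ≤ 3 * η := by
  have hH : ClassH T F := hF.toClassH
  choose f hf hfM using hM
  -- Logarithms of radii with `φ < M`, at least `1` apart, so that the rectangles `B n` are
  -- disjoint.
  let s : ℕ → ℝ := fun n => Nat.rec (Real.log (f (max R₀ 1)))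
    (fun _ x => Real.log (f (Real.exp (x + 1)))) n
  have hs0 : R₀ ≤ Real.exp (s 0) ∧ oneDimProjection T F (Real.exp (s 0)) < M := by
    have h1 : max R₀ 1 ≤ f (max R₀ 1) := hf _
    have h2 : Real.exp (s 0) = f (max R₀ 1) :=
      Real.exp_log (lt_of_lt_of_le one_pos ((le_max_right _ _).trans h1))
    rw [h2]
    exact ⟨(le_max_left _ _).trans h1, hfM _⟩
  have hs1 : ∀ n, s n + 1 ≤ s (n + 1) ∧ oneDimProjection T F (Real.exp (s (n + 1))) < M := by
    intro n
    have h1 : Real.exp (s n + 1) ≤ f (Real.exp (s n + 1)) := hf _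
    have h2 : s (n + 1) = Real.log (f (Real.exp (s n + 1))) := rfl
    have h3 : 0 < f (Real.exp (s n + 1)) := lt_of_lt_of_le (Real.exp_pos _) h1
    rw [h2, Real.exp_log h3]
    exact ⟨(Real.le_log_iff_exp_le h3).2 h1, hfM _⟩
  have hsM : ∀ n, oneDimProjection T F (Real.exp (s n)) < M := by
    rintro (_ | n)
    exacts [hs0.2, (hs1 n).2]
  have hmono : Monotone s := monotone_nat_of_le_succ fun n => by linarith [(hs1 n).1]
  have hsep : ∀ m n, m < n → s m + 1 ≤ s n := fun m n h => (hs1 m).1.trans (hmono h)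
  have hR₀ : ∀ n, R₀ ≤ Real.exp (s n) := fun n =>
    hs0.1.trans (Real.exp_le_exp.2 (hmono (Nat.zero_le n)))
  set E : ℂ → ℂ := fun z => inverseMap T F (Complex.exp z) with hE
  set S : Set ℂ := {z | |z.im| < Real.pi / 2} with hS
  have hEd : DifferentiableOn ℂ E S :=
    hH.differentiableOn_inverseMap.comp Complex.differentiable_exp.differentiableOn
      fun z hz => exp_mem_rightHalfPlane hz
  have hEi : InjOn E S := by
    intro x hx y hy hxy
    have h1 := hH.injOn_inverseMap (exp_mem_rightHalfPlane hx) (exp_mem_rightHalfPlane hy) hxy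
    have hx' := abs_lt.1 (show |x.im| < Real.pi / 2 from hx)
    have hy' := abs_lt.1 (show |y.im| < Real.pi / 2 from hy)
    exact Complex.exp_inj_of_neg_pi_lt_of_le_pi (by linarith [Real.pi_pos])
      (by linarith [Real.pi_pos]) (by linarith [Real.pi_pos]) (by linarith [Real.pi_pos]) h1
  let B : ℕ → Set ℂ := fun n =>
    Ioo (s n) (s n + 1) ×ℂ Ioo (-(Real.pi / 2)) (Real.pi / 2)
  have hBS : ∀ n, B n ⊆ S := fun n z hz => abs_lt.2 ⟨hz.2.1, hz.2.2⟩
  have hBm : ∀ n, MeasurableSet (B n) := fun n =>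
    (isOpen_Ioo.reProdIm isOpen_Ioo).measurableSet
  have hgam : ∀ n, ∀ x ∈ Ioo (s n) (s n + 1),
      ‖inverseMap T F (Real.exp x : ℝ)‖ ≤ M + Real.pi + 2 := by
    intro n x hx
    have h1 := hH.norm_inverseMap_ofReal_sub_le (Real.exp_pos x) (Real.exp_pos (s n))
    rw [Real.log_exp, Real.log_exp, abs_of_pos (by linarith [hx.1])] at h1
    have hmem : ((Real.exp (s n) : ℝ) : ℂ) ∈ rightHalfPlane :=
      ofReal_mem_rightHalfPlane.2 (Real.exp_pos _)
    have h2 := Complex.norm_le_abs_re_add_abs_im (inverseMap T F (Real.exp (s n) : ℝ))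
    have h3 := hH.abs_im_inverseMap_lt hmem
    have h4 := hH.four_lt_re_inverseMap hmem
    have h5 := hsM n
    rw [oneDimProjection_eq] at h5
    rw [abs_of_pos (by linarith)] at h2
    have h6 := norm_le_norm_add_norm_sub (inverseMap T F (Real.exp (s n) : ℝ))
      (inverseMap T F (Real.exp x : ℝ))
    rw [norm_sub_rev] at h6
    linarith [hx.2]
  have hbd : ∀ n, E '' B n ⊆ Metric.closedBall 0 (M + Real.pi + 2 + ν) := by
    rintro n _ ⟨z, hz, rfl⟩
    have h1 := hF.norm_inverseMap_sub_le_nu hν (exp_mem_rightHalfPlane (hBS n hz))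
    rw [Complex.norm_exp] at h1
    have h2 := hgam n z.re hz.1
    have h3 := norm_le_norm_add_norm_sub (inverseMap T F (Real.exp z.re : ℝ)) (E z)
    rw [norm_sub_rev] at h3
    rw [mem_closedBall_zero_iff]
    change ‖E z - inverseMap T F (Real.exp z.re : ℝ)‖ ≤ ν at h1
    linarith
  have hdisj : Pairwise (Function.onFun Disjoint fun n => E '' B n) := by
    have key : ∀ m n, m < n → Disjoint (E '' B m) (E '' B n) := by
      intro m n hmn
      refine Set.disjoint_left.2 ?_
      rintro _ ⟨z, hz, rfl⟩ ⟨z', hz', he⟩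
      obtain rfl := hEi (hBS n hz') (hBS m hz) he
      have h1 := hz.1.2
      have h2 := hz'.1.1
      linarith [hsep m n hmn]
    intro m n hmn
    rcases lt_or_gt_of_ne hmn with h | h
    exacts [key m n h, (key n m h).symm]
  have hmeas : ∀ n, MeasurableSet (E '' B n) := fun n =>
    (hBm n).image_of_continuousOn_injOn (hEd.continuousOn.mono (hBS n)) (hEi.mono (hBS n))
  -- The images are disjoint and, by `ν`, lie in one disc; their areas are summable, hence tend to
  -- zero.
  have hsum : ∑' n, volume (E '' B n) ≠ ⊤ := by
    rw [← measure_iUnion hdisj hmeas]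
    exact ((measure_mono (iUnion_subset hbd)).trans_lt Metric.isBounded_closedBall.measure_lt_top).ne
  have hlim := ENNReal.tendsto_atTop_zero_of_tsum_ne_top hsum
  obtain ⟨n, hn⟩ := ((tendsto_order.1 hlim).2 (ENNReal.ofReal (η ^ 2)) (by positivity)).exists
  obtain ⟨x, hx, hxE⟩ := exists_short_crosscut hη hEd hEi hn.le
  refine ⟨Real.exp x, lt_of_le_of_lt (hR₀ n) (Real.exp_lt_exp.2 hx.1), Real.exp_pos x,
    hgam n x hx, fun w hw hwr => ?_⟩
  have hw' : 0 < w.re := hw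
  have harg : |w.arg| < Real.pi / 2 := Complex.abs_arg_lt_pi_div_two_iff.2 (Or.inl hw')
  have h1 := hxE w.arg 0 harg (by simpa using Real.pi_pos)
  have h2 : Complex.exp (x + w.arg * Complex.I) = w := by
    rw [Complex.exp_add, ← Complex.ofReal_exp, ← hwr]
    exact Complex.norm_mul_exp_arg_mul_I w
  simp only [hE] at h1
  rw [h2] at h1
  simpa using h1

/-- The preimage under `F` of a large half-disc has its frontier in the crosscut and `∂T`. -/
theorem ClassH.frontier_sublevel_subset (hF : ClassH T F) (r : ℝ) :
    frontier (T ∩ F ⁻¹' Metric.ball 0 r) ⊆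
      closure (inverseMap T F '' {w ∈ rightHalfPlane | ‖w‖ = r}) ∪ Tᶜ := by
  have hUo : IsOpen (T ∩ F ⁻¹' Metric.ball 0 r) :=
    hF.differentiableOn.continuousOn.isOpen_inter_preimage hF.isTract.isOpen Metric.isOpen_ball
  intro x hx
  by_cases hxT : x ∈ T
  swap
  · exact Or.inr hxT
  left
  rw [hUo.frontier_eq] at hx
  have h1 : ¬ ‖F x‖ < r := fun h => hx.2 ⟨hxT, by simpa using h⟩
  have h2 : ¬ r < ‖F x‖ := by
    intro h
    have hc : ContinuousAt (fun z => ‖F z‖) x :=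
      (hF.differentiableOn.continuousOn.continuousAt (hF.isTract.isOpen.mem_nhds hxT)).norm
    have hev := hc.eventually (lt_mem_nhds h)
    obtain ⟨y, hy1, hy2⟩ := mem_closure_iff_nhds.1 hx.1 _ hev
    have : ‖F y‖ < r := by simpa using hy2.2
    exact lt_asymm this hy1
  refine subset_closure ⟨F x, ⟨hF.bijOn.mapsTo hxT, by linarith⟩, hF.inverseMap_map hxT⟩

/-- Otherwise images of large semicircles shrink to a finite point `p ∈ ∂T`. Local connectivity
joins the boundary points of such a crosscut by a small connected piece `V` of `∂T`, so crosscut and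
`V` lie in a disc that contains neither `5` nor a far point of `T`. By the Janiszewski-type theorem
these two points are not separated by the frontier of `{|F| < r}`, although that set contains only
`5`. -/
theorem ClassHnu.tendsto_oneDimProjection (hF : ClassHnu ν T F) (hν : 0 ≤ ν) :
    Tendsto (oneDimProjection T F) atTop atTop := by
  have hH : ClassH T F := hF.toClassH
  by_contra hnot
  obtain ⟨M, hM⟩ : ∃ M, ∀ R : ℝ, ∃ t ≥ R, oneDimProjection T F t < M := by
    rw [tendsto_atTop] at hnot
    push Not at hnot
    obtain ⟨M, hM⟩ := hnot
    refine ⟨M, fun R => ?_⟩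
    obtain ⟨t, ht, htM⟩ := (frequently_atTop.1 hM) R
    exact ⟨t, ht, by simpa using htM⟩
  have hex : ∀ k : ℕ, ∃ r : ℝ, (k : ℝ) < r ∧ 0 < r ∧ ‖inverseMap T F r‖ ≤ M + Real.pi + 2 ∧
      ∀ w ∈ rightHalfPlane, ‖w‖ = r →
        ‖inverseMap T F w - inverseMap T F r‖ ≤ 3 * (1 / ((k : ℝ) + 1)) := fun k =>
    hF.exists_small_crosscut hν hM Nat.one_div_pos_of_nat k
  choose r hrk hr0 hrM hrd using hex
  obtain ⟨p, -, ψ, hψ, hp⟩ := tendsto_subseq_of_bounded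
    (Metric.isBounded_closedBall (x := (0 : ℂ)) (r := M + Real.pi + 2))
    (x := fun k => inverseMap T F (r k)) fun k => by simpa using hrM k
  have hrmem : ∀ k, ((r k : ℝ) : ℂ) ∈ rightHalfPlane := fun k =>
    ofReal_mem_rightHalfPlane.2 (hr0 k)
  have hr_top : Tendsto (fun k => r (ψ k)) atTop atTop :=
    (tendsto_atTop_mono (fun k => (hrk k).le) tendsto_natCast_atTop_atTop).comp hψ.tendsto_atTop
  have hpcl : p ∈ closure T := mem_closure_of_tendsto hp
    (Eventually.of_forall fun k => hH.inverseMap_mem (hrmem _))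
  have hpT : p ∉ T := by
    intro hpT
    have hc := (hH.differentiableOn.continuousOn.continuousAt
      (hH.isTract.isOpen.mem_nhds hpT)).norm.tendsto.comp hp
    refine not_tendsto_atTop_of_tendsto_nhds hc (hr_top.congr fun k => ?_)
    simp [hH.map_inverseMap (hrmem _), abs_of_pos (hr0 _)]
  have hpfr : p ∈ frontier T := by
    rw [hH.isTract.isOpen.frontier_eq]
    exact ⟨hpcl, hpT⟩
  have hε : 0 < dist p 5 := dist_pos.2 fun h => hpT (h ▸ hH.isTract.five_mem)
  set ε := dist p 5 with hεdef
  -- a connected piece of the boundary near `p`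
  obtain ⟨V, hVp, hVc, δ, hδ, hδV⟩ : ∃ V : Set ℂ, V ⊆ Metric.ball p ε ∩ Tᶜ ∧ IsPreconnected V ∧
      ∃ δ > 0, Metric.ball p δ ∩ frontier T ⊆ V := by
    have hlc := hH.isTract.locallyConnected_frontier
    have hnb : Subtype.val ⁻¹' Metric.ball p ε ∈ 𝓝 (⟨p, hpfr⟩ : frontier T) :=
      continuous_subtype_val.continuousAt.preimage_mem_nhds (Metric.ball_mem_nhds p hε)
    obtain ⟨V, hV1, hV2, hV3, hV4⟩ :=
      locallyConnectedSpace_iff_subsets_isOpen_isConnected.1 hlc ⟨p, hpfr⟩ _ hnb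
    obtain ⟨δ, hδ, hδV⟩ := Metric.isOpen_iff.1 hV2 _ hV3
    refine ⟨Subtype.val '' V, ?_, hV4.isPreconnected.image _ continuous_subtype_val.continuousOn,
      δ, hδ, ?_⟩
    · rintro _ ⟨x, hx, rfl⟩
      have h1 : (x : ℂ) ∈ closure T \ T := hH.isTract.isOpen.frontier_eq.subset x.2
      exact ⟨hV1 hx, h1.2⟩
    · intro x hx
      exact ⟨⟨x, hx.2⟩, hδV (by simpa [Subtype.dist_eq] using hx.1), rfl⟩
  -- a small crosscut near `p`
  obtain ⟨k, hk5, hkp, hkd⟩ : ∃ k, 5 < r k ∧ dist (inverseMap T F (r k)) p < min δ ε / 3 ∧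
      3 * (1 / ((k : ℝ) + 1)) < min δ ε / 3 := by
    have h3 : 0 < min δ ε / 3 := by positivity
    have h1 := hr_top.eventually_gt_atTop 5
    have h2 := (Metric.tendsto_nhds.1 hp) _ h3
    have h4 : Tendsto (fun k : ℕ => 3 * (1 / ((k : ℝ) + 1))) atTop (𝓝 (3 * 0)) :=
      tendsto_one_div_add_atTop_nhds_zero_nat.const_mul 3
    rw [mul_zero] at h4
    have h5 := (h4.comp hψ.tendsto_atTop).eventually (gt_mem_nhds h3)
    obtain ⟨k, hk1, hk2, hk3⟩ := (h1.and (h2.and h5)).exists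
    exact ⟨ψ k, hk1, hk2, hk3⟩
  set C := closure (inverseMap T F '' {w ∈ rightHalfPlane | ‖w‖ = r k}) with hC
  have hCball : C ⊆ Metric.ball p (min δ ε) := by
    refine (closure_minimal (t := Metric.closedBall p (2 * (min δ ε / 3))) ?_
      Metric.isClosed_closedBall).trans (Metric.closedBall_subset_ball ?_)
    · rintro _ ⟨w, hw, rfl⟩
      have h1 := hrd k w hw.1 hw.2
      rw [← dist_eq_norm] at h1
      have h2 := dist_triangle (inverseMap T F w) (inverseMap T F (r k)) p
      rw [Metric.mem_closedBall]
      linarith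
    · have : 0 < min δ ε := by positivity
      linarith
  have hCT : C ⊆ closure T := closure_mono (by
    rintro _ ⟨w, hw, rfl⟩
    exact hH.inverseMap_mem hw.1)
  -- The image of `b` lies beyond the crosscut, as `|b| > r k`, and outside the `ε`-disc about `p`,
  -- whose radius was chosen to exclude `5`.
  obtain ⟨b, hb, hbr, hbM⟩ := hH.exists_lt_re_inverseMap (r k) (p.re + ε)
  have h5T := hH.isTract.five_mem
  have hmem := mem_of_frontier_subset_union (U := T ∩ F ⁻¹' Metric.ball 0 (r k)) (p := p) (ε := ε)
    (hH.isBounded_sublevel _) hH.isTract.isOpen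
    hH.isTract.isSimplyConnected.isPathConnected.isConnected
    isClosed_closure (hCball.trans (Metric.ball_subset_ball (min_le_right _ _))) hVc
    (fun x hx => (hVp hx).2) (fun x hx => (hVp hx).1)
    (fun x hx => hδV ⟨Metric.ball_subset_ball (min_le_left _ _) (hCball hx.1), by
      rw [hH.isTract.isOpen.frontier_eq]
      exact ⟨hCT hx.1, hx.2⟩⟩)
    (hH.frontier_sublevel_subset (r k)) h5T (hH.inverseMap_mem hb)
    (by rw [Metric.mem_ball, dist_comm, not_lt]) (by
      rw [Metric.mem_ball, not_lt, dist_eq_norm]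
      refine le_trans ?_ (Complex.re_le_norm _)
      rw [Complex.sub_re]
      linarith)
    ⟨h5T, by simpa [hH.map_five] using hk5⟩
  have := hmem.2
  rw [mem_preimage, hH.map_inverseMap hb, mem_ball_zero_iff] at this
  linarith

end

/-! ### Orbits and inverse branches -/

section Orbits

variable {ν : ℝ} {T : Set ℂ} {F : ℂ → ℂ} {s : ℕ → ℤ}

/-- The inverse branches of `F̂ⁿ` along the address `s`. -/
def pullback (T : Set ℂ) (F : ℂ → ℂ) (s : ℕ → ℤ) : ℕ → ℂ → ℂ
  | 0, w => w
  | n + 1, w => pullback T F s n (inverseMap T F w + 2 * Real.pi * Complex.I * s n)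

/-- The half-plane `{Re z ≥ 4}`, in which all orbits in the Julia set stay. -/
def farHalfPlane : Set ℂ := {z | 4 ≤ z.re}

theorem mem_rightHalfPlane_of_four_le {z : ℂ} (hz : 4 ≤ z.re) : z ∈ rightHalfPlane := by
  change 0 < z.re
  linarith

theorem four_le_re_branch (hF : ClassH T F) (n : ℤ) {w : ℂ} (hw : w ∈ rightHalfPlane) :
    4 < (inverseMap T F w + 2 * Real.pi * Complex.I * n).re := by
  have := hF.four_lt_re_inverseMap hw
  simpa using this

theorem branch_mem_translate (hF : ClassH T F) (n : ℤ) {w : ℂ} (hw : w ∈ rightHalfPlane) :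
    inverseMap T F w + 2 * Real.pi * Complex.I * n ∈ translate T n := by
  simpa [translate] using hF.inverseMap_mem hw

theorem periodicExtension_branch (hF : ClassH T F) (n : ℤ) {w : ℂ} (hw : w ∈ rightHalfPlane) :
    periodicExtension T F (inverseMap T F w + 2 * Real.pi * Complex.I * n) = w := by
  rw [periodicExtension_of_mem hF.isTract.subset_halfStrip F (branch_mem_translate hF n hw),
    add_sub_cancel_right, hF.map_inverseMap hw]

theorem iterate_pullback (hF : ClassH T F) (s : ℕ → ℤ) (n : ℕ) {w : ℂ}
    (hw : w ∈ rightHalfPlane) : (periodicExtension T F)^[n] (pullback T F s n w) = w := by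
  induction n generalizing w with
  | zero => rfl
  | succ n ih =>
    rw [Function.iterate_succ_apply', pullback, ih
      (mem_rightHalfPlane_of_four_le (four_le_re_branch hF _ hw).le), periodicExtension_branch hF _ hw]

theorem branch_iterate (hF : ClassH T F) {z : ℂ} (hz : z ∈ juliaSetAt T F s) (n : ℕ) :
    (periodicExtension T F)^[n] z =
      inverseMap T F ((periodicExtension T F)^[n + 1] z) + 2 * Real.pi * Complex.I * s n := by
  have h := hz.2 n
  rw [Function.iterate_succ_apply', periodicExtension_of_mem hF.isTract.subset_halfStrip F h,
    hF.inverseMap_map h, sub_add_cancel]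

theorem four_lt_re_iterate (hF : ClassH T F) {z : ℂ} (hz : z ∈ juliaSetAt T F s) (n : ℕ) :
    4 < ((periodicExtension T F)^[n] z).re := by
  have := (hF.isTract.subset_halfStrip (hz.2 n)).1
  simpa using this

theorem abs_im_iterate_sub_lt (hF : ClassH T F) {z : ℂ} (hz : z ∈ juliaSetAt T F s) (n : ℕ) :
    |((periodicExtension T F)^[n] z).im - 2 * Real.pi * s n| < Real.pi := by
  have := (hF.isTract.subset_halfStrip (hz.2 n)).2
  simpa using this

theorem pullback_iterate (hF : ClassH T F) {z : ℂ} (hz : z ∈ juliaSetAt T F s) (n : ℕ) :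
    pullback T F s n ((periodicExtension T F)^[n] z) = z := by
  induction n with
  | zero => rfl
  | succ n ih => rw [pullback, ← branch_iterate hF hz n, ih]

theorem norm_pullback_sub_le (hF : ClassH T F) (s : ℕ → ℤ) (n : ℕ) {w w' : ℂ}
    (hw : w ∈ farHalfPlane) (hw' : w' ∈ farHalfPlane) :
    ‖pullback T F s n w - pullback T F s n w'‖ ≤ (1 / 2) ^ n * ‖w - w'‖ := by
  induction n generalizing w w' with
  | zero => simp [pullback]
  | succ n ih =>
    have h1 := ih (four_le_re_branch hF (s n) (mem_rightHalfPlane_of_four_le hw)).le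
      (four_le_re_branch hF (s n) (mem_rightHalfPlane_of_four_le hw')).le
    rw [add_sub_add_right_eq_sub] at h1
    have h2 := hF.norm_inverseMap_sub_le hw hw'
    refine h1.trans ?_
    rw [pow_succ, mul_assoc]
    gcongr

/-- Expansion along an address: both points are recovered from their `n`-th iterates by the same
composition of `n` contractions. -/
theorem norm_sub_le_iterate (hF : ClassH T F) {z w : ℂ} (hz : z ∈ juliaSetAt T F s)
    (hw : w ∈ juliaSetAt T F s) (n : ℕ) :
    ‖z - w‖ ≤ (1 / 2) ^ n *
      ‖(periodicExtension T F)^[n] z - (periodicExtension T F)^[n] w‖ := by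
  have := norm_pullback_sub_le hF s n (four_lt_re_iterate hF hz n).le
    (four_lt_re_iterate hF hw n).le
  rwa [pullback_iterate hF hz, pullback_iterate hF hw] at this

/-- A point of the image at stage `n + 1` has its `n`-th iterate in the prescribed translate. The
description as a nested intersection gives closedness and connectedness of the Julia continuum. -/
theorem juliaSetAt_eq_iInter (hF : ClassH T F) :
    juliaSetAt T F s = ⋂ n, pullback T F s n '' farHalfPlane := by
  ext z
  rw [mem_iInter]
  constructor
  · exact fun hz n => ⟨_, (four_lt_re_iterate hF hz n).le, pullback_iterate hF hz n⟩
  · intro h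
    have hmem : ∀ n, (periodicExtension T F)^[n] z ∈ translate T (s n) := by
      intro n
      obtain ⟨w, hw, rfl⟩ := h (n + 1)
      have hw' := mem_rightHalfPlane_of_four_le hw
      rw [pullback, iterate_pullback hF s n
        (mem_rightHalfPlane_of_four_le (four_le_re_branch hF _ hw').le)]
      exact branch_mem_translate hF _ hw'
    obtain ⟨w, hw, hwz⟩ := h 0
    have hzw : w = z := hwz
    exact ⟨⟨mem_rightHalfPlane_of_four_le (hzw ▸ hw), fun n => mem_iUnion.2 ⟨_, hmem n⟩⟩, hmem⟩

theorem antitone_image_pullback (hF : ClassH T F) (s : ℕ → ℤ) :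
    Antitone fun n => pullback T F s n '' farHalfPlane := by
  refine antitone_nat_of_succ_le fun n => ?_
  rintro _ ⟨w, hw, rfl⟩
  exact ⟨_, (four_le_re_branch hF _ (mem_rightHalfPlane_of_four_le hw)).le, rfl⟩

theorem continuousOn_pullback (hF : ClassH T F) (s : ℕ → ℤ) (n : ℕ) :
    ContinuousOn (pullback T F s n) farHalfPlane := by
  induction n with
  | zero => exact continuousOn_id
  | succ n ih =>
    refine ih.comp ((hF.differentiableOn_inverseMap.continuousOn.mono
      fun w hw => mem_rightHalfPlane_of_four_le hw).add continuousOn_const) ?_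
    exact fun w hw => (four_le_re_branch hF _ (mem_rightHalfPlane_of_four_le hw)).le

theorem ClassHnu.tendsto_re_inverseMap (hF : ClassHnu ν T F) (hν : 0 ≤ ν) :
    Tendsto (fun w => (inverseMap T F w).re) (cobounded ℂ ⊓ 𝓟 rightHalfPlane) atTop := by
  have h1 : Tendsto (fun w : ℂ => oneDimProjection T F ‖w‖ - ν) (cobounded ℂ ⊓ 𝓟 rightHalfPlane)
      atTop :=
    tendsto_atTop_add_const_right _ _
      ((hF.tendsto_oneDimProjection hν).comp (tendsto_norm_cobounded_atTop.mono_left inf_le_left))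
  refine tendsto_atTop_mono' _ ?_ h1
  filter_upwards [mem_inf_of_right (mem_principal_self _)] with w hw
  have h2 := hF.norm_inverseMap_sub_le_nu hν hw
  have h3 := (abs_le.1 ((Complex.abs_re_le_norm _).trans h2)).1
  rw [Complex.sub_re] at h3
  rw [oneDimProjection_eq]
  linarith

/-- Inverse branches extend to `∞` by fixing it, so `∞` can be adjoined to their images. -/
theorem ClassHnu.tendsto_pullback (hF : ClassHnu ν T F) (hν : 0 ≤ ν) (s : ℕ → ℤ) (n : ℕ) :
    Tendsto (pullback T F s n) (cobounded ℂ ⊓ 𝓟 farHalfPlane) (cobounded ℂ) := by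
  induction n with
  | zero => exact tendsto_id.mono_left inf_le_left
  | succ n ih =>
    refine ih.comp (tendsto_inf.2 ⟨?_, ?_⟩)
    · rw [← tendsto_norm_atTop_iff_cobounded]
      have h1 := (hF.tendsto_re_inverseMap hν).mono_left
        (inf_le_inf_left (cobounded ℂ) (principal_mono.2
          fun w (hw : w ∈ farHalfPlane) => mem_rightHalfPlane_of_four_le hw))
      refine tendsto_atTop_mono (fun w => ?_) h1
      refine le_trans (le_of_eq ?_) (Complex.re_le_norm _)
      simp
    · refine tendsto_principal.2 ?_
      filter_upwards [mem_inf_of_right (mem_principal_self _)] with w hw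
      exact (four_le_re_branch hF.toClassH _ (mem_rightHalfPlane_of_four_le hw)).le

theorem isClosed_farHalfPlane : IsClosed farHalfPlane :=
  isClosed_le continuous_const Complex.continuous_re

/-- Because the branch tends to `∞` at `∞`, only a compact part of the half-plane is mapped near a
given finite point. -/
theorem ClassHnu.isClosed_image_pullback (hF : ClassHnu ν T F) (hν : 0 ≤ ν) (s : ℕ → ℤ) (n : ℕ) :
    IsClosed (pullback T F s n '' farHalfPlane) := by
  refine isClosed_of_closure_subset fun x hx => ?_
  have h1 := hF.tendsto_pullback hν s n
    (isBounded_def.1 (Metric.isBounded_ball (x := x) (r := 1)))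
  rw [mem_map, mem_inf_principal] at h1
  obtain ⟨R, hR⟩ := (isBounded_compl_iff.2 h1).subset_closedBall 0
  have hK : IsCompact (farHalfPlane ∩ Metric.closedBall 0 R) :=
    (isCompact_closedBall 0 R).inter_left isClosed_farHalfPlane
  have himg := (hK.image_of_continuousOn
    ((continuousOn_pullback hF.toClassH s n).mono inter_subset_left)).isClosed
  have hx2 : x ∈ closure (pullback T F s n '' (farHalfPlane ∩ Metric.closedBall 0 R)) := by
    rw [mem_closure_iff_nhds]
    intro t ht
    obtain ⟨_, hy1, w, hw, rfl⟩ := mem_closure_iff_nhds.1 hx _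
      (inter_mem ht (Metric.ball_mem_nhds x one_pos))
    exact ⟨_, hy1.1, w, ⟨hw, hR fun h => h hw hy1.2⟩, rfl⟩
  rw [himg.closure_eq] at hx2
  exact image_mono inter_subset_left hx2

/-! ### Julia continua are continua -/

theorem tendsto_coe_cobounded_infty :
    Tendsto (fun z : ℂ => (z : OnePoint ℂ)) (cobounded ℂ) (𝓝 OnePoint.infty) := by
  rw [Metric.cobounded_eq_cocompact, ← coclosedCompact_eq_cocompact]
  exact OnePoint.tendsto_coe_infty

theorem isClosed_insert_infty {K : Set ℂ} (hK : IsClosed K) :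
    IsClosed (insert OnePoint.infty ((fun z : ℂ => (z : OnePoint ℂ)) '' K)) := by
  rw [OnePoint.isClosed_iff_of_mem (mem_insert _ _)]
  convert hK
  ext z
  simp

theorem neBot_cobounded_inf_farHalfPlane : (cobounded ℂ ⊓ 𝓟 farHalfPlane).NeBot := by
  have h : Tendsto (fun t : ℝ => (t : ℂ)) atTop (cobounded ℂ ⊓ 𝓟 farHalfPlane) := by
    refine tendsto_inf.2 ⟨?_, tendsto_principal.2 ?_⟩
    · rw [← tendsto_norm_atTop_iff_cobounded]
      simpa using tendsto_abs_atTop_atTop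
    · filter_upwards [eventually_ge_atTop 4] with t ht
      simpa [farHalfPlane] using ht
  exact h.neBot

theorem ClassHnu.isConnected_insert_image_pullback (hF : ClassHnu ν T F) (hν : 0 ≤ ν)
    (s : ℕ → ℤ) (n : ℕ) : IsConnected (insert OnePoint.infty
      ((fun z : ℂ => (z : OnePoint ℂ)) '' (pullback T F s n '' farHalfPlane))) := by
  have hconv : IsConnected farHalfPlane :=
    (convex_halfSpace_re_ge 4).isConnected ⟨(4 : ℂ), by simp⟩
  have h1 := (hconv.image _ (continuousOn_pullback hF.toClassH s n)).image
    (fun z : ℂ => (z : OnePoint ℂ)) OnePoint.continuous_coe.continuousOn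
  refine h1.subset_closure (subset_insert _ _) (insert_subset ?_ subset_closure)
  have := neBot_cobounded_inf_farHalfPlane
  refine mem_closure_of_tendsto (tendsto_coe_cobounded_infty.comp (hF.tendsto_pullback hν s n)) ?_
  filter_upwards [mem_inf_of_right (mem_principal_self _)] with w hw
  exact mem_image_of_mem _ (mem_image_of_mem _ hw)

/-- Disjoint neighbourhoods of the two pieces of a separation would, by compactness, already cover
some `K n`. -/
theorem isConnected_iInter_of_antitone {α : Type*} [TopologicalSpace α] [CompactSpace α]
    [T2Space α] {K : ℕ → Set α} (hK : Antitone K) (hcl : ∀ n, IsClosed (K n))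
    (hc : ∀ n, IsConnected (K n)) : IsConnected (⋂ n, K n) := by
  have hdir : Directed (· ⊇ ·) K := hK.directed_ge
  refine ⟨IsCompact.nonempty_iInter_of_directed_nonempty_isCompact_isClosed K hdir
    (fun n => (hc n).nonempty) (fun n => (hcl n).isCompact) hcl, ?_⟩
  rw [isPreconnected_iff_subset_of_fully_disjoint_closed (isClosed_iInter hcl)]
  intro u v hu hv huv hd
  obtain ⟨U, V, hU, hV, huU, hvV, hUV⟩ := normal_separation hu hv hd
  obtain ⟨n, hn⟩ := exists_subset_nhds_of_isCompact' hdir (fun n => (hcl n).isCompact) hcl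
    (U := U ∪ V) fun x hx => (hU.union hV).mem_nhds ((union_subset_union huU hvV) (huv hx))
  have hdisj : ∀ x, x ∈ U → x ∈ V → False := fun x h h' => disjoint_left.1 hUV h h'
  rcases isPreconnected_iff_subset_of_disjoint.1 (hc n).isPreconnected U V hU hV hn
    (by ext x; constructor
        · rintro ⟨-, h, h'⟩; exact (hdisj x h h').elim
        · rintro ⟨⟩) with h | h
  · refine Or.inl fun x hx => ((huv hx).resolve_right fun hxv => ?_)
    exact hdisj x (h (mem_iInter.1 hx n)) (hvV hxv)
  · refine Or.inr fun x hx => ((huv hx).resolve_left fun hxu => ?_)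
    exact hdisj x (huU hxu) (h (mem_iInter.1 hx n))

theorem juliaSetAtHat_eq_iInter (hF : ClassH T F) :
    juliaSetAtHat T F s = ⋂ n, insert OnePoint.infty
      ((fun z : ℂ => (z : OnePoint ℂ)) '' (pullback T F s n '' farHalfPlane)) := by
  ext x
  rw [juliaSetAtHat, juliaSetAt_eq_iInter hF, mem_iInter]
  induction x using OnePoint.rec with
  | infty => simp
  | coe z => simp [mem_iInter]

theorem ClassHnu.isClosed_juliaSetAtHat (hF : ClassHnu ν T F) (hν : 0 ≤ ν) (s : ℕ → ℤ) :
    IsClosed (juliaSetAtHat T F s) := by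
  rw [juliaSetAtHat_eq_iInter hF.toClassH]
  exact isClosed_iInter fun n => isClosed_insert_infty (hF.isClosed_image_pullback hν s n)

theorem ClassHnu.isConnected_juliaSetAtHat (hF : ClassHnu ν T F) (hν : 0 ≤ ν) (s : ℕ → ℤ) :
    IsConnected (juliaSetAtHat T F s) := by
  rw [juliaSetAtHat_eq_iInter hF.toClassH]
  exact isConnected_iInter_of_antitone
    (fun m n h => insert_subset_insert (image_mono (antitone_image_pullback hF.toClassH s h)))
    (fun n => isClosed_insert_infty (hF.isClosed_image_pullback hν s n))
    (fun n => hF.isConnected_insert_image_pullback hν s n)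

theorem ClassHnu.isContinuum_juliaSetAtHat (hF : ClassHnu ν T F) (hν : 0 ≤ ν) (s : ℕ → ℤ) :
    IsContinuum (juliaSetAtHat T F s) :=
  ⟨isCompact_iff_compactSpace.1 (hF.isClosed_juliaSetAtHat hν s).isCompact,
    isConnected_iff_connectedSpace.1 (hF.isConnected_juliaSetAtHat hν s)⟩

end Orbits

section Coordinates

variable {ν : ℝ} {T : Set ℂ} {F : ℂ → ℂ} {s : ℕ → ℤ}

/-! ### Real coordinates on Julia continua -/

theorem infty_mem_juliaSetAtHat : OnePoint.infty ∈ juliaSetAtHat T F s := mem_insert _ _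

theorem coe_mem_juliaSetAtHat {z : ℂ} : (z : OnePoint ℂ) ∈ juliaSetAtHat T F s ↔
    z ∈ juliaSetAt T F s := by
  simp [juliaSetAtHat]

theorem continuousOn_periodicExtension (hF : ClassH T F) (n : ℤ) :
    ContinuousOn (periodicExtension T F) (translate T n) := by
  have h : ContinuousOn (fun z => F (z - 2 * Real.pi * Complex.I * n)) (translate T n) :=
    hF.differentiableOn.continuousOn.comp (by fun_prop) fun z hz => hz
  exact h.congr fun z hz => periodicExtension_of_mem hF.isTract.subset_halfStrip F hz

theorem continuousOn_iterate (hF : ClassH T F) (n : ℕ) :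
    ContinuousOn (periodicExtension T F)^[n] (juliaSetAt T F s) := by
  induction n with
  | zero => exact continuousOn_id
  | succ n ih =>
    rw [Function.iterate_succ']
    exact (continuousOn_periodicExtension hF (s n)).comp ih fun z hz => hz.2 n

theorem tendsto_iterate (hF : ClassH T F) (n : ℕ) :
    Tendsto (periodicExtension T F)^[n] (cobounded ℂ ⊓ 𝓟 (juliaSetAt T F s)) (cobounded ℂ) := by
  induction n with
  | zero => exact tendsto_id.mono_left inf_le_left
  | succ n ih =>
    have h1 : Tendsto (fun z => (periodicExtension T F)^[n] z - 2 * Real.pi * Complex.I * s n)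
        (cobounded ℂ ⊓ 𝓟 (juliaSetAt T F s)) (cobounded ℂ ⊓ 𝓟 T) := by
      refine tendsto_inf.2 ⟨?_, tendsto_principal.2 ?_⟩
      · exact (tendsto_sub_const_cobounded _).comp ih
      · filter_upwards [mem_inf_of_right (mem_principal_self _)] with z hz using hz.2 n
    refine (hF.tendsto_infty.comp h1).congr' ?_
    filter_upwards [mem_inf_of_right (mem_principal_self _)] with z hz
    rw [Function.iterate_succ_apply',
      periodicExtension_of_mem hF.isTract.subset_halfStrip F (hz.2 n)]
    rfl

/-- At time `n` the imaginary part is bounded in terms of `s n` alone, so a large modulus forces a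
large real part. -/
theorem tendsto_re_iterate (hF : ClassH T F) (n : ℕ) :
    Tendsto (fun z => ((periodicExtension T F)^[n] z).re)
      (cobounded ℂ ⊓ 𝓟 (juliaSetAt T F s)) atTop := by
  have h1 := tendsto_norm_cobounded_atTop.comp (tendsto_iterate (s := s) hF n)
  refine tendsto_atTop_mono' _ ?_
    (tendsto_atTop_add_const_right _ (-(Real.pi + |2 * Real.pi * s n|)) h1)
  filter_upwards [mem_inf_of_right (mem_principal_self _)] with z hz
  have h2 := four_lt_re_iterate hF hz n
  have h3 := abs_im_iterate_sub_lt hF hz n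
  have h4 := Complex.norm_le_abs_re_add_abs_im ((periodicExtension T F)^[n] z)
  rw [abs_of_pos (by linarith)] at h4
  have h5 := abs_sub_abs_le_abs_sub ((periodicExtension T F)^[n] z).im (2 * Real.pi * s n)
  simp only [Function.comp_apply]
  linarith

open Classical in
/-- The coordinate `1 / Re F̂ⁿ(z)` on a Julia continuum, extended by `0` to `∞`. -/
def invCoord (T : Set ℂ) (F : ℂ → ℂ) (s : ℕ → ℤ) (n : ℕ) : OnePoint ℂ → ℝ
  | OnePoint.infty => 0
  | OnePoint.some z => if z ∈ juliaSetAt T F s then 1 / ((periodicExtension T F)^[n] z).re else 0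

theorem invCoord_infty (n : ℕ) : invCoord T F s n OnePoint.infty = 0 := rfl

theorem invCoord_coe {z : ℂ} (hz : z ∈ juliaSetAt T F s) (n : ℕ) :
    invCoord T F s n (z : OnePoint ℂ) = 1 / ((periodicExtension T F)^[n] z).re := if_pos hz

theorem invCoord_coe_pos (hF : ClassH T F) {z : ℂ} (hz : z ∈ juliaSetAt T F s) (n : ℕ) :
    0 < invCoord T F s n (z : OnePoint ℂ) := by
  rw [invCoord_coe hz]
  have := four_lt_re_iterate hF hz n
  positivity

theorem continuousOn_invCoord (hF : ClassH T F) (n : ℕ) :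
    ContinuousOn (invCoord T F s n) (juliaSetAtHat T F s) := by
  intro x hx
  induction x using OnePoint.rec with
  | infty =>
    -- The default value `0` off `J_s` equals the limit at `∞`, so continuity there holds on the
    -- whole sphere.
    refine ContinuousAt.continuousWithinAt ?_
    rw [ContinuousAt, OnePoint.nhds_infty_eq, tendsto_sup]
    refine ⟨?_, tendsto_pure_left.2 fun _ h => mem_of_mem_nhds h⟩
    rw [tendsto_map'_iff, coclosedCompact_eq_cocompact, ← Metric.cobounded_eq_cocompact,
      invCoord_infty]
    have h1 : Tendsto (fun z => 1 / ((periodicExtension T F)^[n] z).re)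
        (cobounded ℂ ⊓ 𝓟 (juliaSetAt T F s)) (𝓝 0) :=
      (tendsto_re_iterate hF n).const_div_atTop 1
    intro t ht
    have h2 := h1 ht
    rw [mem_map, mem_inf_principal] at h2
    rw [mem_map]
    filter_upwards [h2] with z hz
    by_cases hzJ : z ∈ juliaSetAt T F s
    · rw [mem_preimage, Function.comp_apply, invCoord_coe hzJ]
      exact hz hzJ
    · have h3 : invCoord T F s n (z : OnePoint ℂ) = 0 := if_neg hzJ
      rw [mem_preimage, Function.comp_apply, h3]
      exact mem_of_mem_nhds ht
  | coe z =>
    have hz := coe_mem_juliaSetAtHat.1 hx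
    have hpre : (fun z : ℂ => (z : OnePoint ℂ)) ⁻¹' juliaSetAtHat T F s = juliaSetAt T F s := by
      ext w
      exact coe_mem_juliaSetAtHat
    have h1 : ContinuousWithinAt (fun z => 1 / ((periodicExtension T F)^[n] z).re)
        (juliaSetAt T F s) z :=
      continuousWithinAt_const.div
        (Complex.continuous_re.continuousAt.comp_continuousWithinAt (continuousOn_iterate hF n z hz))
        (by linarith [four_lt_re_iterate hF hz n])
    rw [ContinuousWithinAt, OnePoint.nhdsWithin_coe, hpre, tendsto_map'_iff, invCoord_coe hz]
    refine Tendsto.congr' ?_ h1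
    filter_upwards [self_mem_nhdsWithin] with w hw using (invCoord_coe hw n).symm

/-- The values of `Re F̂ⁿ` on the finite part of a subset `A` of the Julia continuum. -/
def reValues (T : Set ℂ) (F : ℂ → ℂ) (s : ℕ → ℤ) (n : ℕ) (A : Set (OnePoint ℂ)) : Set ℝ :=
  {x | ∃ z ∈ juliaSetAt T F s, (z : OnePoint ℂ) ∈ A ∧ ((periodicExtension T F)^[n] z).re = x}

theorem mem_reValues_of_invCoord {n : ℕ} {A : Set (OnePoint ℂ)}
    (hA : A ⊆ juliaSetAtHat T F s) {t : ℝ} (ht : 0 < t)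
    (h : 1 / t ∈ invCoord T F s n '' A) : t ∈ reValues T F s n A := by
  obtain ⟨x, hx, hxt⟩ := h
  induction x using OnePoint.rec with
  | infty =>
    rw [invCoord_infty] at hxt
    have : 0 < 1 / t := by positivity
    linarith
  | coe z =>
    have hz := coe_mem_juliaSetAtHat.1 (hA hx)
    refine ⟨z, hz, hx, ?_⟩
    rw [invCoord_coe hz, one_div, one_div, inv_inj] at hxt
    exact hxt

theorem ordConnected_invCoord_image (hF : ClassH T F) (n : ℕ) {A : Set (OnePoint ℂ)}
    (hA : A ⊆ juliaSetAtHat T F s) (hAc : IsPreconnected A) :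
    (invCoord T F s n '' A).OrdConnected :=
  (hAc.image _ ((continuousOn_invCoord hF n).mono hA)).ordConnected

theorem ordConnected_reValues (hF : ClassH T F) (n : ℕ) {A : Set (OnePoint ℂ)}
    (hA : A ⊆ juliaSetAtHat T F s) (hAc : IsPreconnected A) :
    (reValues T F s n A).OrdConnected := by
  refine ⟨?_⟩
  rintro _ ⟨z, hz, hzA, rfl⟩ _ ⟨w, hw, hwA, rfl⟩ t ht
  have hz4 := four_lt_re_iterate hF hz n
  have ht0 : 0 < t := by linarith [ht.1]
  refine mem_reValues_of_invCoord hA ht0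
    ((ordConnected_invCoord_image hF n hA hAc).out ⟨w, hwA, rfl⟩ ⟨z, hzA, rfl⟩ ?_)
  rw [invCoord_coe hz, invCoord_coe hw]
  exact ⟨one_div_le_one_div_of_le ht0 ht.2, one_div_le_one_div_of_le (by linarith) ht.1⟩

theorem mem_reValues_of_infty_mem (hF : ClassH T F) (n : ℕ) {A : Set (OnePoint ℂ)}
    (hA : A ⊆ juliaSetAtHat T F s) (hAc : IsPreconnected A) (hinf : OnePoint.infty ∈ A) {z : ℂ}
    (hz : z ∈ juliaSetAt T F s) (hzA : (z : OnePoint ℂ) ∈ A) {t : ℝ}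
    (ht : ((periodicExtension T F)^[n] z).re ≤ t) : t ∈ reValues T F s n A := by
  have hz4 := four_lt_re_iterate hF hz n
  have ht0 : 0 < t := by linarith
  refine mem_reValues_of_invCoord hA ht0
    ((ordConnected_invCoord_image hF n hA hAc).out ⟨_, hinf, rfl⟩ ⟨z, hzA, rfl⟩ ?_)
  rw [invCoord_coe hz, invCoord_infty]
  exact ⟨by positivity, one_div_le_one_div_of_le (by linarith) ht⟩

/-! ### Julia continua are arc-like -/

/-- The chordal distance is exactly `2|z - w| / √((1 + |z|²)(1 + |w|²))`. -/
theorem dist_coe_le (z w : ℂ) : dist (z : OnePoint ℂ) (w : OnePoint ℂ) ≤ 2 * ‖z - w‖ := by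
  have h0 : dist (z : OnePoint ℂ) (w : OnePoint ℂ) = dist (toSphere z) (toSphere w) := rfl
  rw [h0, toSphere_coe, toSphere_coe, WithLp.prod_dist_eq_of_L2]
  refine Real.sqrt_le_iff.2 ⟨by positivity, ?_⟩
  simp only [dist_eq_norm, mul_pow, Real.norm_eq_abs, sq_abs]
  have hA : 0 < 1 + ‖z‖ ^ 2 := by positivity
  have hB : 0 < 1 + ‖w‖ ^ 2 := by positivity
  have hz := Complex.sq_norm z
  have hw := Complex.sq_norm w
  rw [Complex.normSq_apply] at hz hw
  have key : ‖((2 / (1 + ‖z‖ ^ 2) : ℝ) : ℂ) * z - ((2 / (1 + ‖w‖ ^ 2) : ℝ) : ℂ) * w‖ ^ 2 +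
      ((‖z‖ ^ 2 - 1) / (‖z‖ ^ 2 + 1) - (‖w‖ ^ 2 - 1) / (‖w‖ ^ 2 + 1)) ^ 2 =
      2 ^ 2 * ‖z - w‖ ^ 2 / ((1 + ‖z‖ ^ 2) * (1 + ‖w‖ ^ 2)) := by
    rw [Complex.sq_norm (_ * z - _), Complex.sq_norm (z - w), Complex.normSq_apply,
      Complex.normSq_apply, add_comm (‖z‖ ^ 2) 1, add_comm (‖w‖ ^ 2) 1]
    simp only [Complex.sub_re, Complex.sub_im, Complex.re_ofReal_mul, Complex.im_ofReal_mul]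
    have hA' : 1 + (z.re * z.re + z.im * z.im) ≠ 0 := by rw [← hz]; exact hA.ne'
    have hB' : 1 + (w.re * w.re + w.im * w.im) ≠ 0 := by rw [← hw]; exact hB.ne'
    rw [hz, hw]
    field_simp
    ring
  refine (le_of_eq key).trans (div_le_self (by positivity) ?_)
  nlinarith [sq_nonneg ‖z‖, sq_nonneg ‖w‖, mul_nonneg (sq_nonneg ‖z‖) (sq_nonneg ‖w‖)]

/-- The `n`-th iterates lie in the same strip of height `2π`, so real parts control their distance;
contraction does the rest. -/
theorem norm_sub_le_of_re_iterate_eq (hF : ClassH T F) {z w : ℂ} (hz : z ∈ juliaSetAt T F s)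
    (hw : w ∈ juliaSetAt T F s) {n : ℕ} {C : ℝ}
    (h : |((periodicExtension T F)^[n] z).re - ((periodicExtension T F)^[n] w).re| ≤ C) :
    ‖z - w‖ ≤ (1 / 2) ^ n * (C + 2 * Real.pi) := by
  refine (norm_sub_le_iterate hF hz hw n).trans ?_
  gcongr
  refine (Complex.norm_le_abs_re_add_abs_im _).trans ?_
  rw [Complex.sub_re, Complex.sub_im]
  have h1 := abs_lt.1 (abs_im_iterate_sub_lt hF hz n)
  have h2 := abs_lt.1 (abs_im_iterate_sub_lt hF hw n)
  have h3 : |((periodicExtension T F)^[n] z).im - ((periodicExtension T F)^[n] w).im| ≤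
      2 * Real.pi := abs_le.2 ⟨by linarith, by linarith⟩
  linarith

/-- The map is `1 / Re F̂ⁿ` divided by its maximum. It is onto by connectedness, and a finite fibre
has chordal diameter at most `2 · 2⁻ⁿ · 2π`, whence the `4π` in the choice of `n`. -/
theorem ClassHnu.isArcLike_juliaSetAtHat (hF : ClassHnu ν T F) (hν : 0 ≤ ν)
    (hne : (juliaSetAt T F s).Nonempty) : IsArcLike (juliaSetAtHat T F s) := by
  have hH : ClassH T F := hF.toClassH
  refine ⟨hF.isContinuum_juliaSetAtHat hν s, fun ε hε => ?_⟩
  obtain ⟨n, hn⟩ : ∃ n : ℕ, (1 / 2 : ℝ) ^ n < ε / (4 * Real.pi) :=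
    exists_pow_lt_of_lt_one (by positivity) (by norm_num)
  obtain ⟨z₀, hz₀⟩ := hne
  have hcpt : IsCompact (juliaSetAtHat T F s) := (hF.isClosed_juliaSetAtHat hν s).isCompact
  obtain ⟨x₁, hx₁, hmax⟩ := hcpt.exists_isMaxOn ⟨_, infty_mem_juliaSetAtHat⟩
    (continuousOn_invCoord hH n)
  set m := invCoord T F s n x₁ with hm
  have hmpos : 0 < m := lt_of_lt_of_le (invCoord_coe_pos hH hz₀ n)
    (hmax (coe_mem_juliaSetAtHat.2 hz₀))
  have hnn : ∀ x ∈ juliaSetAtHat T F s, 0 ≤ invCoord T F s n x := by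
    intro x hx
    induction x using OnePoint.rec with
    | infty => exact le_rfl
    | coe z => exact (invCoord_coe_pos hH (coe_mem_juliaSetAtHat.1 hx) n).le
  have hcont : Continuous fun x : juliaSetAtHat T F s => invCoord T F s n x / m :=
    (continuousOn_iff_continuous_domRestrict.1 (continuousOn_invCoord hH n)).div_const m
  have hmem : ∀ x : juliaSetAtHat T F s, invCoord T F s n x / m ∈ Icc (0 : ℝ) 1 := fun x =>
    ⟨div_nonneg (hnn x x.2) hmpos.le, (div_le_one hmpos).2 (hmax x.2)⟩
  refine ⟨fun x => ⟨invCoord T F s n x / m, hmem x⟩, hcont.subtype_mk _, ?_, ?_⟩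
  · rintro ⟨t, ht⟩
    have h1 := (ordConnected_invCoord_image hH n Subset.rfl
      (hF.isConnected_juliaSetAtHat hν s).isPreconnected).out
      ⟨_, infty_mem_juliaSetAtHat, rfl⟩ ⟨x₁, hx₁, rfl⟩
      (show t * m ∈ Icc (invCoord T F s n OnePoint.infty) m from
        ⟨by rw [invCoord_infty]; exact mul_nonneg ht.1 hmpos.le,
          mul_le_of_le_one_left hmpos.le ht.2⟩)
    obtain ⟨x, hx, hxt⟩ := h1
    refine ⟨⟨x, hx⟩, Subtype.ext ?_⟩
    change invCoord T F s n x / m = t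
    rw [hxt, mul_div_cancel_right₀ _ hmpos.ne']
  · intro t
    refine Metric.diam_le_of_forall_dist_le hε.le ?_
    rintro ⟨x, hx⟩ hxt ⟨y, hy⟩ hyt
    have hxy : invCoord T F s n x = invCoord T F s n y := by
      have h1 := congrArg Subtype.val (hxt.trans hyt.symm)
      exact (div_left_inj' hmpos.ne').1 h1
    change dist x y ≤ ε
    induction x using OnePoint.rec with
    | infty =>
      induction y using OnePoint.rec with
      | infty => simpa using hε.le
      | coe w =>
        have h2 := invCoord_coe_pos hH (coe_mem_juliaSetAtHat.1 hy) n
        rw [← hxy, invCoord_infty] at h2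
        exact (lt_irrefl _ h2).elim
    | coe z =>
      induction y using OnePoint.rec with
      | infty =>
        have h2 := invCoord_coe_pos hH (coe_mem_juliaSetAtHat.1 hx) n
        rw [hxy, invCoord_infty] at h2
        exact (lt_irrefl _ h2).elim
      | coe w =>
        have hz := coe_mem_juliaSetAtHat.1 hx
        have hw := coe_mem_juliaSetAtHat.1 hy
        rw [invCoord_coe hz, invCoord_coe hw, one_div, one_div, inv_inj] at hxy
        have h3 := norm_sub_le_of_re_iterate_eq hH hz hw (n := n) (C := 0) (by simp [hxy])
        refine (dist_coe_le z w).trans ?_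
        rw [lt_div_iff₀ (by positivity)] at hn
        linarith

end Coordinates

/-! ### Intervals of the real line -/

/-- Take the first point `q'` where `f = y` and then the last point `p'` before it where `f = x`. -/
theorem exists_image_Icc_eq_of_le {f : ℝ → ℝ} {p q x y : ℝ} (hpq : p ≤ q)
    (hf : ContinuousOn f (Icc p q)) (hx : f p ≤ x) (hxy : x ≤ y) (hy : y ≤ f q) :
    ∃ p' q', p' ≤ q' ∧ Icc p' q' ⊆ Icc p q ∧ f '' Icc p' q' = Icc x y := by
  have hK : IsCompact (Icc p q ∩ f ⁻¹' {y}) :=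
    isCompact_Icc.of_isClosed_subset
      (hf.preimage_isClosed_of_isClosed isClosed_Icc isClosed_singleton) inter_subset_left
  obtain ⟨q', ⟨hq'I, hq'y⟩, hq'min⟩ := hK.exists_isLeast (by
    obtain ⟨t, ht, hty⟩ := intermediate_value_Icc hpq hf ⟨hx.trans hxy, hy⟩
    exact ⟨t, ht, hty⟩)
  have hq'y : f q' = y := hq'y
  have hf' : ContinuousOn f (Icc p q') := hf.mono (Icc_subset_Icc_right hq'I.2)
  have hK' : IsCompact (Icc p q' ∩ f ⁻¹' {x}) :=
    isCompact_Icc.of_isClosed_subset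
      (hf'.preimage_isClosed_of_isClosed isClosed_Icc isClosed_singleton) inter_subset_left
  obtain ⟨p', ⟨hp'I, hp'x⟩, hp'max⟩ := hK'.exists_isGreatest (by
    obtain ⟨t, ht, htx⟩ := intermediate_value_Icc hq'I.1 hf' ⟨hx, hxy.trans hq'y.ge⟩
    exact ⟨t, ht, htx⟩)
  have hp'x : f p' = x := hp'x
  refine ⟨p', q', hp'I.2, Icc_subset_Icc hp'I.1 hq'I.2, Subset.antisymm ?_ ?_⟩
  · rintro _ ⟨t, ht, rfl⟩
    constructor
    · by_contra! hlt
      obtain ⟨u, hu, hux⟩ := intermediate_value_Icc ht.2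
        (hf'.mono (Icc_subset_Icc_left (hp'I.1.trans ht.1))) ⟨hlt.le, hxy.trans hq'y.ge⟩
      have h1 : u ≤ p' := hp'max ⟨⟨(hp'I.1.trans ht.1).trans hu.1, hu.2⟩, hux⟩
      have h2 : t = p' := le_antisymm (hu.1.trans h1) ht.1
      rw [h2, hp'x] at hlt
      exact lt_irrefl _ hlt
    · by_contra! hlt
      obtain ⟨u, hu, huy⟩ := intermediate_value_Icc (hp'I.1.trans ht.1)
        (hf'.mono (Icc_subset_Icc_right ht.2)) ⟨hx.trans hxy, hlt.le⟩
      have h1 : q' ≤ u := hq'min ⟨⟨hu.1, (hu.2.trans ht.2).trans hq'I.2⟩, huy⟩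
      have h2 : t = q' := le_antisymm ht.2 (h1.trans hu.2)
      rw [h2, hq'y] at hlt
      exact lt_irrefl _ hlt
  · have := intermediate_value_Icc hp'I.2 (hf'.mono (Icc_subset_Icc_left hp'I.1))
    rwa [hp'x, hq'y] at this

/-- An interval between the values of a continuous function at two points is the exact image of an
interval between these points. -/
theorem exists_image_Icc_eq {f : ℝ → ℝ} {p q x y : ℝ} (hf : ContinuousOn f (uIcc p q))
    (hx : f p ≤ x) (hxy : x ≤ y) (hy : y ≤ f q) :
    ∃ p' q', p' ≤ q' ∧ Icc p' q' ⊆ uIcc p q ∧ f '' Icc p' q' = Icc x y := by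
  rcases le_total p q with h | h
  · rw [uIcc_of_le h] at hf ⊢
    exact exists_image_Icc_eq_of_le h hf hx hxy hy
  · rw [uIcc_of_ge h] at hf ⊢
    have hg : ContinuousOn (fun t => f (-t)) (Icc (-p) (-q)) :=
      hf.comp continuousOn_neg fun t ht => ⟨by linarith [ht.2], by linarith [ht.1]⟩
    obtain ⟨p', q', hpq', hsub, himg⟩ := exists_image_Icc_eq_of_le (neg_le_neg h) hg
      (by simpa using hx) hxy (by simpa using hy)
    refine ⟨-q', -p', neg_le_neg hpq', ?_, ?_⟩
    · intro t ht
      have := hsub (⟨by linarith [ht.2], by linarith [ht.1]⟩ : -t ∈ Icc p' q')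
      exact ⟨by linarith [this.2], by linarith [this.1]⟩
    · rw [← himg, ← image_neg_Icc, image_image]

/-- Removing an interval `V` from an interval `U` can leave two pieces only if `V` lies inside `U`.
-/
theorem convex_diff_of_ordConnected {U V : Set ℝ} (hU : U.OrdConnected) (hV : V.OrdConnected)
    (hne : (V \ U).Nonempty) : Convex ℝ (U \ V) := by
  refine OrdConnected.convex ⟨fun x hx y hy t ht => ⟨hU.out hx.1 hy.1 ht, fun htV => ?_⟩⟩
  obtain ⟨v, hv, hvU⟩ := hne
  rcases lt_or_ge v x with h | h
  · exact hx.2 (hV.out hv htV ⟨h.le, ht.1⟩)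
  · rcases lt_or_ge y v with h' | h'
    · exact hy.2 (hV.out htV hv ⟨ht.2, h'.le⟩)
    · exact hvU (hU.out hx.1 hy.1 ⟨h, h'⟩)

theorem abs_log_sub_log_le {x y κ : ℝ} (hx : 4 ≤ x) (hy : 4 ≤ y) (hκ : 0 ≤ κ)
    (hxy : x ≤ 2 * y + κ) (hyx : y ≤ 2 * x + κ) : |Real.log x - Real.log y| ≤ 1 + κ / 16 := by
  have key : ∀ a b : ℝ, 4 ≤ a → 4 ≤ b → a ≤ 2 * b + κ →
      Real.log a - Real.log b ≤ 1 + κ / 16 := by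
    intro a b ha hb hab
    -- As `b ≥ 4`, `a ≤ (2 + κ/4) b`, and `log (2 + κ/4) ≤ 2 log 2 + (1/2 + κ/16) - 1`. Splitting
    -- off `log 4` yields the slope `1/16`, small enough for the shadowing error to close up.
    have hc : 0 < 2 + κ / 4 := by positivity
    have h1 : a ≤ (2 + κ / 4) * b := by nlinarith
    have h2 := Real.log_le_log (by linarith) h1
    rw [Real.log_mul hc.ne' (by linarith)] at h2
    have h3 := Real.log_le_sub_one_of_pos (x := (2 + κ / 4) / 4) (by positivity)
    rw [Real.log_div hc.ne' (by norm_num)] at h3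
    have h4 : Real.log 4 = 2 * Real.log 2 := by
      rw [show (4 : ℝ) = 2 ^ 2 by norm_num, Real.log_pow]
      norm_num
    have h5 := Real.log_two_lt_d9
    linarith
  exact abs_le.2 ⟨by linarith [key y x hy hx hyx], key x y hx hy hxy⟩

section Tracking

variable {ν : ℝ} {T : Set ℂ} {F : ℂ → ℂ} {s : ℕ → ℤ}

/-! ### Comparison with the one-dimensional projection -/

/-- The height `max (Re F̂ⁿ(z), 2π|sₙ|)`. -/
def height (T : Set ℂ) (F : ℂ → ℂ) (s : ℕ → ℤ) (n : ℕ) (z : ℂ) : ℝ :=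
  max ((periodicExtension T F)^[n] z).re (2 * Real.pi * |(s n : ℝ)|)

theorem four_lt_height (hF : ClassH T F) {z : ℂ} (hz : z ∈ juliaSetAt T F s) (n : ℕ) :
    4 < height T F s n z :=
  lt_max_of_lt_left (four_lt_re_iterate hF hz n)

theorem abs_address_le_height (n : ℕ) (z : ℂ) : 2 * Real.pi * |(s n : ℝ)| ≤ height T F s n z :=
  le_max_right _ _

theorem abs_im_iterate_le (hF : ClassH T F) {z : ℂ} (hz : z ∈ juliaSetAt T F s) (n : ℕ) :
    |((periodicExtension T F)^[n] z).im| ≤ 2 * Real.pi * |(s n : ℝ)| + Real.pi ∧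
      2 * Real.pi * |(s n : ℝ)| ≤ |((periodicExtension T F)^[n] z).im| + Real.pi := by
  have h1 := abs_im_iterate_sub_lt hF hz n
  have h2 : |2 * Real.pi * (s n : ℝ)| = 2 * Real.pi * |(s n : ℝ)| := by
    rw [abs_mul, abs_of_pos Real.two_pi_pos]
  have h3 := abs_sub_abs_le_abs_sub ((periodicExtension T F)^[n] z).im (2 * Real.pi * s n)
  have h4 := abs_sub_abs_le_abs_sub (2 * Real.pi * s n) ((periodicExtension T F)^[n] z).im
  rw [abs_sub_comm] at h4
  rw [h2] at h3 h4
  constructor <;> linarith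

/-- With its companion `height_le_norm_iterate`, this makes height and modulus comparable up to a
factor `2` and an additive `π`, which the logarithm absorbs. Unlike the modulus, the height is a
monotone function of the real part alone. -/
theorem norm_iterate_le_height (hF : ClassH T F) {z : ℂ} (hz : z ∈ juliaSetAt T F s) (n : ℕ) :
    ‖(periodicExtension T F)^[n] z‖ ≤ 2 * height T F s n z + Real.pi := by
  have h1 := Complex.norm_le_abs_re_add_abs_im ((periodicExtension T F)^[n] z)
  have h2 := four_lt_re_iterate hF hz n
  rw [abs_of_pos (by linarith)] at h1
  have h3 := (abs_im_iterate_le hF hz n).1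
  have h4 : ((periodicExtension T F)^[n] z).re ≤ height T F s n z := le_max_left _ _
  have h5 := abs_address_le_height (T := T) (F := F) (s := s) n z
  linarith

theorem height_le_norm_iterate (hF : ClassH T F) {z : ℂ} (hz : z ∈ juliaSetAt T F s) (n : ℕ) :
    height T F s n z ≤ ‖(periodicExtension T F)^[n] z‖ + Real.pi := by
  refine max_le ?_ ?_
  · linarith [Complex.re_le_norm ((periodicExtension T F)^[n] z), Real.pi_pos]
  · linarith [(abs_im_iterate_le hF hz n).2, Complex.abs_im_le_norm ((periodicExtension T F)^[n] z)]

theorem four_le_norm_iterate (hF : ClassH T F) {z : ℂ} (hz : z ∈ juliaSetAt T F s) (n : ℕ) :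
    4 ≤ ‖(periodicExtension T F)^[n] z‖ :=
  (four_lt_re_iterate hF hz n).le.trans (Complex.re_le_norm _)

theorem ClassHnu.abs_re_iterate_sub_le (hF : ClassHnu ν T F) (hν : 0 ≤ ν) {z : ℂ}
    (hz : z ∈ juliaSetAt T F s) (n : ℕ) :
    |((periodicExtension T F)^[n] z).re -
      oneDimProjection T F ‖(periodicExtension T F)^[n + 1] z‖| ≤ ν := by
  have hw := mem_rightHalfPlane_of_four_le (four_lt_re_iterate hF.toClassH hz (n + 1)).le
  have h1 : ((periodicExtension T F)^[n] z).re =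
      (inverseMap T F ((periodicExtension T F)^[n + 1] z)).re := by
    rw [branch_iterate hF.toClassH hz n]
    simp
  rw [h1, oneDimProjection_eq, ← Complex.sub_re]
  exact (Complex.abs_re_le_norm _).trans (hF.norm_inverseMap_sub_le_nu hν hw)

/-- One step of the comparison between orbits of `F̂` and orbits of `φ`. -/
theorem ClassHnu.abs_oneDimProjection_sub_re_le (hF : ClassHnu ν T F) (hν : 0 ≤ ν) {z : ℂ}
    (hz : z ∈ juliaSetAt T F s) (n : ℕ) {u : ℝ} (hu : 4 ≤ u)
    (h : |u - height T F s (n + 1) z| ≤ 2 * ν + 4) :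
    |oneDimProjection T F u - ((periodicExtension T F)^[n] z).re| ≤ 2 * ν + 4 := by
  have hH := hF.toClassH
  have h1 := hF.abs_re_iterate_sub_le hν hz n
  have h2 := norm_iterate_le_height hH hz (n + 1)
  have h3 := height_le_norm_iterate hH hz (n + 1)
  have h4 := four_le_norm_iterate hH hz (n + 1)
  have h5 := abs_le.1 h
  have hpi := Real.pi_pos
  have hpi4 := Real.pi_le_four
  -- The total error is `ν + 2(1 + κ/16) = 3ν/2 + 3 + π/8 ≤ 2ν + 4`: the admissible error reproduces
  -- itself.
  have h6 := abs_log_sub_log_le (κ := 2 * (2 * ν + 4) + Real.pi) hu h4 (by linarith)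
    (by linarith) (by linarith)
  have h7 := hH.abs_oneDimProjection_sub_le (x := u) (by linarith)
    (y := ‖(periodicExtension T F)^[n + 1] z‖) (by linarith)
  have h8 := abs_le.1 h1
  have h9 := abs_le.1 (h7.trans (mul_le_mul_of_nonneg_left h6 zero_le_two))
  exact abs_le.2 ⟨by linarith, by linarith⟩

/-- Points at a definite distance have very different heights at large times. -/
theorem ClassHnu.exists_lt_abs_height_sub (hF : ClassHnu ν T F) (hν : 0 ≤ ν) (s : ℕ → ℤ)
    {H δ : ℝ} (hH0 : 0 ≤ H) (hδ : 0 < δ) : ∃ n₀ : ℕ, ∀ n ≥ n₀, ∀ z ∈ juliaSetAt T F s,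
      ∀ w ∈ juliaSetAt T F s, δ ≤ ‖z - w‖ → H < |height T F s n z - height T F s n w| := by
  have hH := hF.toClassH
  -- Heights within `H` give moduli satisfying `|F̂ⁿz| ≤ 2|F̂ⁿw| + 2H + 3π`. One step earlier the
  -- real parts then differ by at most `C - 2π`, so contraction makes `z` and `w` closer than `δ`.
  set κ := 2 * H + 3 * Real.pi with hκ
  set C := 2 * ν + 2 * (1 + κ / 16) + 2 * Real.pi with hC
  have hκ0 : 0 < κ := by positivity
  have hC0 : 0 < C := by positivity
  obtain ⟨m, hm⟩ : ∃ m : ℕ, (1 / 2 : ℝ) ^ m < δ / C :=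
    exists_pow_lt_of_lt_one (by positivity) (by norm_num)
  refine ⟨m + 1, fun n hn z hz w hw hδzw => ?_⟩
  obtain ⟨k, rfl⟩ : ∃ k, n = k + 1 := ⟨n - 1, by omega⟩
  by_contra! hle
  have hpi := Real.pi_pos
  have h0 := abs_le.1 hle
  have h1 := norm_iterate_le_height hH hz (k + 1)
  have h2 := norm_iterate_le_height hH hw (k + 1)
  have h3 := height_le_norm_iterate hH hz (k + 1)
  have h4 := height_le_norm_iterate hH hw (k + 1)
  have hz4 := four_le_norm_iterate hH hz (k + 1)
  have hw4 := four_le_norm_iterate hH hw (k + 1)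
  have h5 := abs_log_sub_log_le (κ := κ) hz4 hw4 hκ0.le (by linarith) (by linarith)
  have h6 := hH.abs_oneDimProjection_sub_le (x := ‖(periodicExtension T F)^[k + 1] z‖)
    (by linarith) (y := ‖(periodicExtension T F)^[k + 1] w‖) (by linarith)
  have h7 := abs_le.1 (h6.trans (mul_le_mul_of_nonneg_left h5 zero_le_two))
  have h8 := abs_le.1 (hF.abs_re_iterate_sub_le hν hz k)
  have h9 := abs_le.1 (hF.abs_re_iterate_sub_le hν hw k)
  have h10 := norm_sub_le_of_re_iterate_eq hH hz hw (n := k) (C := 2 * ν + 2 * (1 + κ / 16))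
    (abs_le.2 ⟨by linarith, by linarith⟩)
  have h11 : (1 / 2 : ℝ) ^ k ≤ (1 / 2) ^ m :=
    pow_le_pow_of_le_one (by norm_num) (by norm_num) (by omega)
  have h12 : (1 / 2 : ℝ) ^ k * C < δ := by
    rw [lt_div_iff₀ hC0] at hm
    exact lt_of_le_of_lt (mul_le_mul_of_nonneg_right h11 hC0.le) hm
  rw [← hC] at h10
  linarith

/-- Lifting of an interval between the heights of two points under iterates of `φ`, in such a way
that its orbit shadows points of the Julia continuum. -/
theorem ClassHnu.exists_lift_interval (hF : ClassHnu ν T F) (hν : 0 ≤ ν) {a b : ℂ}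
    (ha : a ∈ juliaSetAt T F s) (hb : b ∈ juliaSetAt T F s) {n : ℕ}
    (hab : ∀ j ≥ n, 2 * (2 * ν + 4) < |height T F s j a - height T F s j b|) {x y : ℝ}
    (hxy : x ≤ y)
    (hx : min (height T F s n a) (height T F s n b) + (2 * ν + 4) ≤ x)
    (hy : y ≤ max (height T F s n a) (height T F s n b) - (2 * ν + 4)) (k : ℕ) :
    ∃ x' y', x' ≤ y' ∧
      min (height T F s (n + k) a) (height T F s (n + k) b) + (2 * ν + 4) ≤ x' ∧
      y' ≤ max (height T F s (n + k) a) (height T F s (n + k) b) - (2 * ν + 4) ∧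
      (oneDimProjection T F)^[k] '' Icc x' y' = Icc x y ∧
      ∀ t ∈ Icc x' y', ∀ z ∈ juliaSetAt T F s, |t - height T F s (n + k) z| ≤ 2 * ν + 4 →
        |(oneDimProjection T F)^[k] t - height T F s n z| ≤ 2 * ν + 4 := by
  have hH := hF.toClassH
  induction k with
  | zero => exact ⟨x, y, hxy, hx, hy, by simp, fun t _ z _ h => h⟩
  | succ k ih =>
    obtain ⟨x', y', hxy', hx', hy', himg, htr⟩ := ih
    set M := 2 * ν + 4 with hM
    have hM0 : 0 < M := by linarith
    have key : ∀ p ∈ juliaSetAt T F s, ∀ q ∈ juliaSetAt T F s,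
        2 * M < height T F s (n + k) q - height T F s (n + k) p →
        height T F s (n + k) p + M ≤ x' → y' ≤ height T F s (n + k) q - M →
        2 * M < |height T F s (n + (k + 1)) p - height T F s (n + (k + 1)) q| →
        ∃ x'' y'', x'' ≤ y'' ∧
          min (height T F s (n + (k + 1)) p) (height T F s (n + (k + 1)) q) + M ≤ x'' ∧
          y'' ≤ max (height T F s (n + (k + 1)) p) (height T F s (n + (k + 1)) q) - M ∧
          oneDimProjection T F '' Icc x'' y'' = Icc x' y' := by
      intro p hp q hq hpq hpx hqy hpq'
      -- The address term is also a lower bound for the height of `p`; the higher point `q` exceeds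
      -- it, so its height is its real part.
      have hqre : height T F s (n + k) q = ((periodicExtension T F)^[n + k] q).re := by
        refine max_eq_left ?_
        by_contra! hlt
        have h1 : height T F s (n + k) q = 2 * Real.pi * |(s (n + k) : ℝ)| := max_eq_right hlt.le
        have h2 := abs_address_le_height (T := T) (F := F) (s := s) (n + k) p
        linarith
      have hpre : ((periodicExtension T F)^[n + k] p).re ≤ height T F s (n + k) p :=
        le_max_left _ _
      have hp4 := four_lt_height hH hp (n + (k + 1))
      have hq4 := four_lt_height hH hq (n + (k + 1))
      -- Move both heights inward by `M`. One shadowing step then puts `φ u` below `x'` and `φ v`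
      -- above `y'`, whichever of `u`, `v` is larger; the order of the heights may change with time.
      obtain ⟨u, v, hu4, hv4, hup, hvq, hmin, hmax⟩ : ∃ u v : ℝ, 4 ≤ u ∧ 4 ≤ v ∧
          |u - height T F s (n + k + 1) p| ≤ M ∧ |v - height T F s (n + k + 1) q| ≤ M ∧
          min (height T F s (n + (k + 1)) p) (height T F s (n + (k + 1)) q) + M ≤ min u v ∧
          max u v ≤ max (height T F s (n + (k + 1)) p) (height T F s (n + (k + 1)) q) - M := by
        have e : n + k + 1 = n + (k + 1) := rfl
        rw [e]
        rcases le_total (height T F s (n + (k + 1)) p) (height T F s (n + (k + 1)) q) with h | h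
        · rw [abs_of_nonpos (by linarith)] at hpq'
          refine ⟨height T F s (n + (k + 1)) p + M, height T F s (n + (k + 1)) q - M,
            by linarith, by linarith, ?_, ?_, ?_, ?_⟩
          · simp [abs_of_pos hM0]
          · rw [sub_sub_cancel_left, abs_neg, abs_of_pos hM0]
          · rw [min_eq_left h]
            exact le_min le_rfl (by linarith)
          · rw [max_eq_right h]
            exact max_le (by linarith) le_rfl
        · rw [abs_of_nonneg (by linarith)] at hpq'
          refine ⟨height T F s (n + (k + 1)) p - M, height T F s (n + (k + 1)) q + M,
            by linarith, by linarith, ?_, ?_, ?_, ?_⟩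
          · rw [sub_sub_cancel_left, abs_neg, abs_of_pos hM0]
          · simp [abs_of_pos hM0]
          · rw [min_eq_right h]
            exact le_min (by linarith) le_rfl
          · rw [max_eq_left h]
            exact max_le le_rfl (by linarith)
      have h1 := abs_le.1 (hF.abs_oneDimProjection_sub_re_le hν hp (n + k) hu4 hup)
      have h2 := abs_le.1 (hF.abs_oneDimProjection_sub_re_le hν hq (n + k) hv4 hvq)
      have hcont : ContinuousOn (oneDimProjection T F) (uIcc u v) :=
        hH.continuousOn_oneDimProjection.mono fun t ht => by
          have : min u v ≤ t := ht.1
          have h4 : 4 ≤ min u v := le_min hu4 hv4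
          exact lt_of_lt_of_le (by linarith) this
      obtain ⟨x'', y'', hle, hsub, himg'⟩ := exists_image_Icc_eq hcont
        (by linarith [h1.2] : oneDimProjection T F u ≤ x') hxy'
        (by linarith [h2.1] : y' ≤ oneDimProjection T F v)
      have hsx : min u v ≤ x'' := (hsub (left_mem_Icc.2 hle)).1
      have hsy : y'' ≤ max u v := (hsub (right_mem_Icc.2 hle)).2
      exact ⟨x'', y'', hle, hmin.trans hsx, hsy.trans hmax, himg'⟩
    obtain ⟨x'', y'', hle, hx'', hy'', himg'⟩ : ∃ x'' y'', x'' ≤ y'' ∧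
          min (height T F s (n + (k + 1)) a) (height T F s (n + (k + 1)) b) + M ≤ x'' ∧
          y'' ≤ max (height T F s (n + (k + 1)) a) (height T F s (n + (k + 1)) b) - M ∧
          oneDimProjection T F '' Icc x'' y'' = Icc x' y' := by
      have hk := hab (n + k) (Nat.le_add_right _ _)
      have hk1 := hab (n + (k + 1)) (Nat.le_add_right _ _)
      rcases le_total (height T F s (n + k) a) (height T F s (n + k) b) with h | h
      · rw [min_eq_left h] at hx'
        rw [max_eq_right h] at hy'
        rw [abs_of_nonpos (by linarith)] at hk
        exact key a ha b hb (by linarith) hx' hy' hk1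
      · rw [min_eq_right h] at hx'
        rw [max_eq_left h] at hy'
        rw [abs_of_nonneg (by linarith)] at hk
        rw [min_comm, max_comm]
        rw [abs_sub_comm] at hk1
        exact key b hb a ha (by linarith) hx' hy' hk1
    refine ⟨x'', y'', hle, hx'', hy'', ?_, fun t ht z hz htz => ?_⟩
    · rw [Function.iterate_succ, image_comp, himg', himg]
    · have hφt : oneDimProjection T F t ∈ Icc x' y' := himg' ▸ mem_image_of_mem _ ht
      have h4t : 4 ≤ t := by
        have h1 : 4 < min (height T F s (n + (k + 1)) a) (height T F s (n + (k + 1)) b) :=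
          lt_min (four_lt_height hH ha _) (four_lt_height hH hb _)
        linarith [ht.1]
      have h2 := hF.abs_oneDimProjection_sub_re_le hν hz (n + k) h4t htz
      -- Above the address term `φ t` equals its maximum with it. Taking this maximum is
      -- 1-Lipschitz, so closeness to the real part passes to the height.
      have h3 : 2 * Real.pi * |(s (n + k) : ℝ)| ≤ oneDimProjection T F t := by
        have h1 : 2 * Real.pi * |(s (n + k) : ℝ)| ≤
            min (height T F s (n + k) a) (height T F s (n + k) b) :=
          le_min (abs_address_le_height _ _) (abs_address_le_height _ _)
        linarith [hφt.1]
      rw [Function.iterate_succ_apply]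
      refine htr _ hφt z hz (le_trans ?_ h2)
      have h5 := abs_max_sub_max_le_abs (oneDimProjection T F t)
        ((periodicExtension T F)^[n + k] z).re (2 * Real.pi * |(s (n + k) : ℝ)|)
      rwa [max_eq_left h3] at h5

end Tracking

/-! ### Hereditary indecomposability -/

/-- All sufficiently long iterates of `φ` are crooked over all large integer quadruples. -/
def EventuallyCrooked (φ : ℝ → ℝ) : Prop :=
  ∃ K : ℝ, 0 < K ∧ ∀ Q : Quadruple, Q.IsInteger → K ≤ Q.size →
    ∃ k₀ : ℕ, ∀ k : ℕ, k₀ ≤ k → ∀ a b : ℝ, 6 ≤ a → a ≤ b →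
      Icc Q.A Q.D ⊆ φ^[k] '' Icc a b → MapsCrookedly φ k (Icc a b) Q

section Indecomposable

variable {ν : ℝ} {T : Set ℂ} {F : ℂ → ℂ} {s : ℕ → ℤ}

/-- The heights on the finite part of a subset `A` of the Julia continuum. -/
def heightValues (T : Set ℂ) (F : ℂ → ℂ) (s : ℕ → ℤ) (n : ℕ) (A : Set (OnePoint ℂ)) : Set ℝ :=
  {x | ∃ z ∈ juliaSetAt T F s, (z : OnePoint ℂ) ∈ A ∧ height T F s n z = x}

/-- Along one address the height is a fixed continuous function of the real part, whose values form
an interval. -/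
theorem ordConnected_heightValues (hF : ClassH T F) (n : ℕ) {A : Set (OnePoint ℂ)}
    (hA : A ⊆ juliaSetAtHat T F s) (hAc : IsPreconnected A) :
    (heightValues T F s n A).OrdConnected := by
  have h1 : heightValues T F s n A =
      (fun x => max x (2 * Real.pi * |(s n : ℝ)|)) '' reValues T F s n A := by
    ext x
    constructor
    · rintro ⟨z, hz, hzA, rfl⟩
      exact ⟨_, ⟨z, hz, hzA, rfl⟩, rfl⟩
    · rintro ⟨_, ⟨z, hz, hzA, rfl⟩, rfl⟩
      exact ⟨z, hz, hzA, rfl⟩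
  rw [h1]
  have h2 := (ordConnected_reValues hF n hA hAc).isPreconnected
  exact (h2.image _ (by fun_prop)).ordConnected

/-- A connected set through `∞` attains every real part above that of any of its finite points. This
settles continua that meet at `∞`. -/
theorem heightValues_mem_upper (hF : ClassH T F) (n : ℕ) {A : Set (OnePoint ℂ)}
    (hA : A ⊆ juliaSetAtHat T F s) (hAc : IsPreconnected A) (hinf : OnePoint.infty ∈ A) {a b : ℂ}
    (ha : a ∈ juliaSetAt T F s) (haA : (a : OnePoint ℂ) ∈ A)
    (hab : ((periodicExtension T F)^[n] a).re ≤ ((periodicExtension T F)^[n] b).re) :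
    height T F s n b ∈ heightValues T F s n A := by
  obtain ⟨z, hz, hzA, hzb⟩ := mem_reValues_of_infty_mem hF n hA hAc hinf ha haA hab
  exact ⟨z, hz, hzA, by rw [height, height, hzb]⟩

theorem exists_integer_quadruple {K M H p r : ℝ} (hK : 0 < K) (hM : 0 ≤ M) (hp : 0 ≤ p)
    (hH : 2 * M + 2 * K + 25 ≤ H) (hpr : p + 2 * H ≤ r) :
    ∃ Q : Quadruple, Q.IsInteger ∧ K ≤ Q.size ∧ p + M ≤ Q.A ∧ Q.B + M < p + H ∧
      r - H < Q.C - M ∧ Q.D ≤ r - M := by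
  have hL1 := Int.le_ceil K
  have hL2 := Int.ceil_lt_add_one K
  have hA1 := Int.le_ceil (p + M)
  have hA2 := Int.ceil_lt_add_one (p + M)
  have hD1 := Int.floor_le (r - M)
  have hD2 := Int.lt_floor_add_one (r - M)
  set L := ⌈K⌉
  set A := ⌈p + M⌉
  set D := ⌊r - M⌋
  -- Rounded endpoints with gaps `L + 9`, where `L = ⌈K⌉`: the `9` ensures entries at least `9` and
  -- `Q.A - 5 ≥ K`. Rounding and gaps fit into the constant `25` in `hH`.
  refine ⟨⟨(A : ℝ) + (L + 9), A + 2 * (L + 9), D - (L + 9), D, by linarith, by linarith, by linarith,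
    by linarith⟩, ⟨A + (L + 9), A + 2 * (L + 9), D - (L + 9), D, ?_, ?_, ?_, ?_⟩, ?_, ?_, ?_, ?_, ?_⟩
  · push_cast; ring
  · push_cast; ring
  · push_cast; ring
  · rfl
  · refine le_min ?_ (le_min ?_ (le_min ?_ ?_)) <;> simp only <;> linarith
  all_goals simp only
  all_goals linarith

/-- Two intersecting subcontinua of a Julia continuum cannot be such that, from some time on, they
contain points whose heights are far from all heights on the other subcontinuum. -/
theorem ClassHnu.false_of_height_gaps (hF : ClassHnu ν T F) (hν : 0 ≤ ν) {K : ℝ} (hK : 0 < K)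
    (hcr : ∀ Q : Quadruple, Q.IsInteger → K ≤ Q.size →
      ∃ k₀ : ℕ, ∀ k : ℕ, k₀ ≤ k → ∀ a b : ℝ, 6 ≤ a → a ≤ b →
        Icc Q.A Q.D ⊆ (oneDimProjection T F)^[k] '' Icc a b →
          MapsCrookedly (oneDimProjection T F) k (Icc a b) Q)
    {A B : Set (OnePoint ℂ)} (hA : A ⊆ juliaSetAtHat T F s) (hB : B ⊆ juliaSetAtHat T F s)
    (hAc : IsPreconnected A) (hBc : IsPreconnected B) {a b c : ℂ} (ha : a ∈ juliaSetAt T F s)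
    (hb : b ∈ juliaSetAt T F s) (hc : c ∈ juliaSetAt T F s) (haA : (a : OnePoint ℂ) ∈ A)
    (hbB : (b : OnePoint ℂ) ∈ B) (hcA : (c : OnePoint ℂ) ∈ A) (hcB : (c : OnePoint ℂ) ∈ B) {n : ℕ}
    {H : ℝ} (hH : 2 * (2 * ν + 4) + 2 * K + 25 ≤ H)
    (haB : ∀ j ≥ n, ∀ z ∈ juliaSetAt T F s, (z : OnePoint ℂ) ∈ B →
      H < |height T F s j a - height T F s j z|)
    (hbA : ∀ z ∈ juliaSetAt T F s, (z : OnePoint ℂ) ∈ A →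
      H < |height T F s n b - height T F s n z|)
    (hab : height T F s n a ≤ height T F s n b) : False := by
  have hH' := hF.toClassH
  set M := 2 * ν + 4 with hM
  have hM0 : 4 ≤ M := by linarith
  have ha4 := four_lt_height hH' ha n
  -- all heights on `B` are above that of `a`, and all heights on `A` are below that of `b`
  have hBabove : ∀ z ∈ juliaSetAt T F s, (z : OnePoint ℂ) ∈ B →
      height T F s n a + H < height T F s n z := by
    intro z hz hzB
    have h1 := haB n le_rfl z hz hzB
    rcases le_total (height T F s n a) (height T F s n z) with h | h
    · rw [abs_of_nonpos (by linarith)] at h1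
      linarith
    · obtain ⟨w, hw, hwB, hwa⟩ := (ordConnected_heightValues hH' n hB hBc).out
        ⟨z, hz, hzB, rfl⟩ ⟨b, hb, hbB, rfl⟩ ⟨h, hab⟩
      have h2 := haB n le_rfl w hw hwB
      rw [hwa, sub_self, abs_zero] at h2
      linarith
  have hAbelow : ∀ z ∈ juliaSetAt T F s, (z : OnePoint ℂ) ∈ A →
      height T F s n z < height T F s n b - H := by
    intro z hz hzA
    have h1 := hbA z hz hzA
    rcases le_total (height T F s n z) (height T F s n b) with h | h
    · rw [abs_of_nonneg (by linarith)] at h1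
      linarith
    · obtain ⟨w, hw, hwA, hwb⟩ := (ordConnected_heightValues hH' n hA hAc).out
        ⟨a, ha, haA, rfl⟩ ⟨z, hz, hzA, rfl⟩ ⟨hab, h⟩
      have h2 := hbA w hw hwA
      rw [hwb, sub_self, abs_zero] at h2
      linarith
  have hc1 := hBabove c hc hcB
  have hc2 := hAbelow c hc hcA
  obtain ⟨Q, hQint, hQsize, hQA, hQB, hQC, hQD⟩ := exists_integer_quadruple (M := M) (H := H)
    (p := height T F s n a) (r := height T F s n b) hK (by linarith) (by linarith) hH (by linarith)
  have hAB := Q.A_lt_B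
  have hBC := Q.B_lt_C
  have hCD := Q.C_lt_D
  obtain ⟨k, hk⟩ := hcr Q hQint hQsize
  -- Lift by exactly the `k` steps that crookedness over `Q` requires; `a` and `b` remain far apart
  -- in height at all these times.
  obtain ⟨x, y, hxy, hx, hy, himg, htr⟩ := hF.exists_lift_interval hν ha hb (n := n)
    (fun j hj => by linarith [haB j hj b hb hbB]) (x := Q.A) (y := Q.D) (by linarith)
    (by rw [min_eq_left hab]; exact hQA) (by rw [max_eq_right hab]; exact hQD) k
  have hJ : Icc x y ⊆ uIcc (height T F s (n + k) a) (height T F s (n + k) b) := by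
    refine fun t ht => ⟨?_, ?_⟩
    · linarith [ht.1]
    · linarith [ht.2]
  have h6 : 6 ≤ x := by
    have h1 : 4 < min (height T F s (n + k) a) (height T F s (n + k) b) :=
      lt_min (four_lt_height hH' ha _) (four_lt_height hH' hb _)
    linarith
  obtain ⟨-, v, hvB, hvC⟩ := hk k le_rfl x y h6 hxy himg.ge
  set U := heightValues T F s (n + k) A with hU
  set V := heightValues T F s (n + k) B with hV
  have hUo : U.OrdConnected := ordConnected_heightValues hH' _ hA hAc
  have hVo : V.OrdConnected := ordConnected_heightValues hH' _ hB hBc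
  have hJUV : Icc x y ⊆ U ∪ V := by
    intro t ht
    rcases uIcc_subset_uIcc_union_uIcc (b := height T F s (n + k) c) (hJ ht) with h | h
    · exact Or.inl (hUo.uIcc_subset ⟨a, ha, haA, rfl⟩ ⟨c, hc, hcA, rfl⟩ h)
    · exact Or.inr (hVo.uIcc_subset ⟨c, hc, hcB, rfl⟩ ⟨b, hb, hbB, rfl⟩ h)
  -- Were such a `t` the height of a point of `B`, shadowing would put that point at time `n` within
  -- `M` of `Q.B`, but heights on `B` exceed `Q.B + M`. The case of `Q.C` is symmetric.
  have hpreB : Icc x y ∩ (oneDimProjection T F)^[k] ⁻¹' {Q.B} ⊆ U \ V := by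
    rintro t ⟨ht, htB⟩
    have htB : (oneDimProjection T F)^[k] t = Q.B := htB
    have htV : t ∉ V := by
      rintro ⟨z, hz, hzB, rfl⟩
      have h1 := htr _ ht z hz (by rw [sub_self, abs_zero]; linarith)
      rw [htB] at h1
      linarith [(abs_le.1 h1).1, hBabove z hz hzB]
    exact ⟨(hJUV ht).resolve_right htV, htV⟩
  have hpreC : Icc x y ∩ (oneDimProjection T F)^[k] ⁻¹' {Q.C} ⊆ V \ U := by
    rintro t ⟨ht, htC⟩
    have htC : (oneDimProjection T F)^[k] t = Q.C := htC
    have htU : t ∉ U := by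
      rintro ⟨z, hz, hzA, rfl⟩
      have h1 := htr _ ht z hz (by rw [sub_self, abs_zero]; linarith)
      rw [htC] at h1
      linarith [(abs_le.1 h1).2, hAbelow z hz hzA]
    exact ⟨(hJUV ht).resolve_left htU, htU⟩
  have hneB : (U \ V).Nonempty := by
    obtain ⟨t, ht, htB⟩ := himg.ge (⟨hAB.le, by linarith⟩ : Q.B ∈ Icc Q.A Q.D)
    exact ⟨t, hpreB ⟨ht, htB⟩⟩
  have hneC : (V \ U).Nonempty := by
    obtain ⟨t, ht, htC⟩ := himg.ge (⟨by linarith, hCD.le⟩ : Q.C ∈ Icc Q.A Q.D)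
    exact ⟨t, hpreC ⟨ht, htC⟩⟩
  -- Both differences are convex and they are disjoint, yet they contain the two hulls, which share
  -- `v`.
  have h1 := convexHull_min hpreB (convex_diff_of_ordConnected hUo hVo hneC) hvB
  have h2 := convexHull_min hpreC (convex_diff_of_ordConnected hVo hUo hneB) hvC
  exact h2.2 h1.1

/-- A non-degenerate connected set that is not contained in a closed set has a finite point outside
of it. -/
theorem exists_finite_mem_diff {A B : Set (OnePoint ℂ)} (hA : IsPreconnected A)
    (hB : IsClosed B) (hAB : (A ∩ B).Nonempty) (hnot : ¬ A ⊆ B) :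
    ∃ z : ℂ, (z : OnePoint ℂ) ∈ A ∧ (z : OnePoint ℂ) ∉ B := by
  by_contra! hcon
  have hinf : ∀ x ∈ A, x ∉ B → x = OnePoint.infty := by
    intro x hx hxB
    induction x using OnePoint.rec with
    | infty => rfl
    | coe z => exact (hxB (hcon z hx)).elim
  obtain ⟨x, hx, hxB⟩ := not_subset.1 hnot
  obtain rfl := hinf x hx hxB
  -- If only `∞` lay outside `B`, then `A` would split into the closed pieces `A ∩ B` and `{∞}`.
  obtain ⟨y, -, hyB, hy⟩ := isPreconnected_closed_iff.1 hA B {OnePoint.infty} hB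
    OnePoint.isClosed_infty
    (fun z hz => by
      by_cases h : z ∈ B
      exacts [Or.inl h, Or.inr (hinf z hz h)])
    hAB ⟨_, hx, rfl⟩
  rw [mem_singleton_iff.1 hy] at hyB
  exact hxB hyB

theorem exists_dist_of_notMem {B : Set (OnePoint ℂ)} (hB : IsClosed B) {a : ℂ}
    (ha : (a : OnePoint ℂ) ∉ B) : ∃ δ > 0, ∀ z : ℂ, (z : OnePoint ℂ) ∈ B → δ ≤ ‖a - z‖ := by
  have h1 : IsOpen ((fun z : ℂ => (z : OnePoint ℂ)) ⁻¹' Bᶜ) :=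
    hB.isOpen_compl.preimage OnePoint.continuous_coe
  obtain ⟨δ, hδ, hsub⟩ := Metric.isOpen_iff.1 h1 a ha
  refine ⟨δ, hδ, fun z hz => ?_⟩
  by_contra! hlt
  refine hsub ?_ hz
  rwa [Metric.mem_ball, dist_comm, dist_eq_norm]

theorem ClassHnu.subset_or_subset (hF : ClassHnu ν T F) (hν : 0 ≤ ν)
    (hcr : EventuallyCrooked (oneDimProjection T F)) {A B : Set (OnePoint ℂ)}
    (hA : A ⊆ juliaSetAtHat T F s) (hB : B ⊆ juliaSetAtHat T F s) (hAcl : IsClosed A)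
    (hBcl : IsClosed B) (hAc : IsPreconnected A) (hBc : IsPreconnected B)
    (hAB : (A ∩ B).Nonempty) : A ⊆ B ∨ B ⊆ A := by
  by_contra! hcon
  have hH' := hF.toClassH
  obtain ⟨K, hK, hcr⟩ := hcr
  obtain ⟨a, haA, haB⟩ := exists_finite_mem_diff hAc hBcl hAB hcon.1
  obtain ⟨b, hbB, hbA⟩ := exists_finite_mem_diff hBc hAcl (by rwa [inter_comm]) hcon.2
  have ha := coe_mem_juliaSetAtHat.1 (hA haA)
  have hb := coe_mem_juliaSetAtHat.1 (hB hbB)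
  obtain ⟨δ₁, hδ₁, hd₁⟩ := exists_dist_of_notMem hBcl haB
  obtain ⟨δ₂, hδ₂, hd₂⟩ := exists_dist_of_notMem hAcl hbA
  set H := 2 * (2 * ν + 4) + 2 * K + 25 with hH
  have hH0 : 0 ≤ H := by positivity
  obtain ⟨n₁, hn₁⟩ := hF.exists_lt_abs_height_sub hν s hH0 hδ₁
  obtain ⟨n₂, hn₂⟩ := hF.exists_lt_abs_height_sub hν s hH0 hδ₂
  set n := max n₁ n₂
  have haB' : ∀ j ≥ n, ∀ z ∈ juliaSetAt T F s, (z : OnePoint ℂ) ∈ B →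
      H < |height T F s j a - height T F s j z| := fun j hj z hz hzB =>
    hn₁ j ((le_max_left _ _).trans hj) a ha z hz (hd₁ z hzB)
  have hbA' : ∀ j ≥ n, ∀ z ∈ juliaSetAt T F s, (z : OnePoint ℂ) ∈ A →
      H < |height T F s j b - height T F s j z| := fun j hj z hz hzA =>
    hn₂ j ((le_max_right _ _).trans hj) b hb z hz (hd₂ z hzA)
  obtain ⟨c, hcA, hcB⟩ := hAB
  induction c using OnePoint.rec with
  | infty =>
    -- The continuum through the point with the smaller real part extends to `∞`, so it attains the
    -- height of the other point, against the gap.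
    rcases le_total ((periodicExtension T F)^[n] a).re ((periodicExtension T F)^[n] b).re
      with h | h
    · obtain ⟨z, hz, hzA, hzb⟩ := heightValues_mem_upper hH' n hA hAc hcA ha haA h
      have := hbA' n le_rfl z hz hzA
      rw [hzb, sub_self, abs_zero] at this
      linarith
    · obtain ⟨z, hz, hzB, hza⟩ := heightValues_mem_upper hH' n hB hBc hcB hb hbB h
      have := haB' n le_rfl z hz hzB
      rw [hza, sub_self, abs_zero] at this
      linarith
  | coe c =>
    have hc := coe_mem_juliaSetAtHat.1 (hA hcA)
    rcases le_total (height T F s n a) (height T F s n b) with h | h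
    · exact hF.false_of_height_gaps hν hK hcr hA hB hAc hBc ha hb hc haA hbB hcA hcB le_rfl haB'
        (hbA' n le_rfl) h
    · exact hF.false_of_height_gaps hν hK hcr hB hA hBc hAc hb ha hc hbB haA hcB hcA le_rfl hbA'
        (haB' n le_rfl) h

theorem ClassHnu.isHereditarilyIndecomposable_juliaSetAtHat (hF : ClassHnu ν T F) (hν : 0 ≤ ν)
    (hcr : EventuallyCrooked (oneDimProjection T F)) (s : ℕ → ℤ) :
    IsHereditarilyIndecomposable (juliaSetAtHat T F s) := by
  refine ⟨hF.isContinuum_juliaSetAtHat hν s, fun A B hAk hAc hBk hBc hAB => ?_⟩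
  have hsub : ∀ A : Set (juliaSetAtHat T F s), Subtype.val '' A ⊆ juliaSetAtHat T F s := by
    rintro A _ ⟨x, -, rfl⟩
    exact x.2
  have h := hF.subset_or_subset hν hcr (hsub A) (hsub B)
    (hAk.image continuous_subtype_val).isClosed (hBk.image continuous_subtype_val).isClosed
    (hAc.isPreconnected.image _ continuous_subtype_val.continuousOn)
    (hBc.isPreconnected.image _ continuous_subtype_val.continuousOn)
    (by
      obtain ⟨x, hx⟩ := hAB
      exact ⟨x, ⟨x, hx.1, rfl⟩, ⟨x, hx.2, rfl⟩⟩)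
  rwa [image_subset_image_iff Subtype.val_injective,
    image_subset_image_iff Subtype.val_injective] at h

end Indecomposable

end PseudoArcModels

end

theorem theorem5p1 (ν : ℝ) (hν : 0 < ν) (T : Set ℂ) (F : ℂ → ℂ)
    (hF : PseudoArcModels.ClassHnu ν T F)
    (hcrooked : ∃ K : ℝ, 0 < K ∧
      ∀ Q : PseudoArcModels.Quadruple, Q.IsInteger → K ≤ Q.size →
        ∃ k₀ : ℕ, ∀ k : ℕ, k₀ ≤ k → ∀ a b : ℝ, 6 ≤ a → a ≤ b →
          Set.Icc Q.A Q.D ⊆ (PseudoArcModels.oneDimProjection T F)^[k] '' Set.Icc a b →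
          PseudoArcModels.MapsCrookedly (PseudoArcModels.oneDimProjection T F) k
            (Set.Icc a b) Q) :
    ∀ X : Set (OnePoint ℂ), PseudoArcModels.IsJuliaContinuum T F X →
      PseudoArcModels.IsPseudoArc X := by
  rintro X ⟨s, hne, rfl⟩
  exact ⟨hF.isHereditarilyIndecomposable_juliaSetAtHat hν.le hcrooked s,
    hF.isArcLike_juliaSetAtHat hν.le hne⟩
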